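/- Let $f:\mathbb{R}^n\to\mathbb{R}$ and $\varphi:\mathbb{R}^n\to\mathbb{R}\cup\{\infty\}$, where $f$ is continuously differentiable on an open set containing $\operatorname{dom}\varphi$, $\varphi$ is proper, lower semicontinuous and prox-bounded (for some $\gamma>0$ and some $x$, $\inf_y\{\varphi(y)+\frac1{2\gamma}\|y-x\|^2\}>-\infty$), and $F:=f+\varphi$ is bounded from below. Assume that every $x\in\operatorname{dom}\varphi$ has a ball around it on which $\nabla f$ is Lipschitz. $\partial F$ denotes the limiting subdifferential. Let $c_1\in(0,1)$, $\sigma_2>1$, $0<\mu_{\min}\le\mu_{\max}<\infty$, and let $x^k\in\mathbb{R}^n$, $B_k\in\mathbb{R}^{n\times n}$, $\mu_k>0$ be generated as follows. Start with $x^0\in\operatorname{dom}\varphi$, $\mu_0\in[\mu_{\min},\mu_{\max}]$ and any $B_0$. For $k=0,1,2,\dots$ let $q_k(x)=f(x^k)+\nabla f(x^k)^\top(x-x^k)+\frac12(x-x^k)^\top B_k(x-x^k)+\varphi(x)$, and let $\hat x^k$ be a global minimizer of $q_k(x)+\frac{\mu_k}{2}\|x-x^k\|^2$ whenever one exists. Iteration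 $k$ is successful if such $\hat x^k$ exists and $F(x^k)-F(\hat x^k)\ge c_1\,(F(x^k)-q_k(\hat x^k))$; then $x^{k+1}=\hat x^k$, $\mu_{k+1}\in[\mu_{\min},\mu_{\max}]$ is arbitrary and $B_{k+1}$ is arbitrary. Otherwise $x^{k+1}=x^k$, $B_{k+1}=B_k$, $\mu_{k+1}=\sigma_2\mu_k$. Let $\mathcal S$ be the set of successful iterations. Assume that $\{B_k\}$ is bounded and that $\{x^k\}_{k\in\mathcal S}$ has an accumulation point $x^*$ with $0\in\partial F(x^*)$. Suppose that $F$ has the Kurdyka–Łojasiewicz property at $x^*$ with desingularization function $\chi(t)=c\,t^{1-\theta}$ for some $c>0$, $\theta\in(0,1)$, i.e. there are $\eta>0$ and a neighborhood $U$ of $x^*$ with $$\chi'(F(x)-F(x^*))\,\operatorname{dist}(0,\partial F(x))\ge 1\quad\text{for all }x\in U\text{ with }F(x^*)<F(x)<F(x^*)+\eta .$$ Then $F(x^*)$ and all $F(x^k)$ are finite. Moreover, let $k_0\in\mathcal S$ be arbitrary. Then there are infinitely many successful iterations, and if $k_0=s_0<s_1<s_2<\cdots$ denote the successful iterations $\ge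 k_0$, the sequence $\{s_{j+1}-s_j\}$ is bounded, and: (a) If $\theta\in(0,\frac12)$, then $\{F(x^{s_k})\}$ converges Q-superlinearly to $F(x^*)$ with rate $\frac1{2\theta}$, and $\{x^{s_k}\}$ converges R-superlinearly to $x^*$ with the same rate. (b) If $\theta=\frac12$, then $\{F(x^{s_k})\}$ converges Q-linearly to $F(x^*)$, and $\{x^{s_k}\}$ converges R-linearly to $x^*$. (c) If $\theta\in(\frac12,1)$, then there are constants $C_1,C_2>0$ such that for all sufficiently large $k$ $$F(x^{s_k})-F(x^*)\le C_1k^{-\frac1{2\theta-1}},\qquad \|x^{s_k}-x^*\|\le C_2k^{-\frac{1-\theta}{2\theta-1}} .$$ Here $u_k\to u$ is Q-linear if $\|u_{k+1}-u\|\le q\|u_k-u\|$ for some $q\in(0,1)$ and all large $k$; it is Q-superlinear with rate $p>1$ if $u_k\to u$ and $\|u_{k+1}-u\|\le C\|u_k-u\|^p$ for some $C>0$ and all large $k$; it is R-linear (R-superlinear with rate $p$) if $\|u_k-u\|\le\nu_k$ for all $k$ with a sequence $\nu_k$ converging Q-linearly (Q-superlinearly with rate $p$) to $0$. -/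

import Mathlib

open Filter Topology

/-! ### Extended-valued functions on Euclidean space

Functions `ℝⁿ → ℝ ∪ {∞}` are modelled as functions into `EReal` that avoid `⊥`
(this is part of `IsProper`). -/

/-- The domain `{x | g x < ∞}`. -/
def effDom {n : ℕ} (g : EuclideanSpace ℝ (Fin n) → EReal) : Set (EuclideanSpace ℝ (Fin n)) :=
  {x | g x < ⊤}

/-- `g` takes values in `ℝ ∪ {∞}` and has nonempty domain. -/
def IsProper {n : ℕ} (g : EuclideanSpace ℝ (Fin n) → EReal) : Prop :=
  (∀ x, g x ≠ ⊥) ∧ (effDom g).Nonempty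

/-- The Moreau envelope `x ↦ inf_y (g y + ‖y - x‖² / (2γ))`. -/
noncomputable def moreauEnvelope {n : ℕ} (g : EuclideanSpace ℝ (Fin n) → EReal) (γ : ℝ)
    (x : EuclideanSpace ℝ (Fin n)) : EReal :=
  ⨅ y, g y + ((1 / (2 * γ) * ‖y - x‖ ^ 2 : ℝ) : EReal)

/-- Prox-boundedness: some Moreau envelope is `> -∞` at some point. -/
def ProxBounded {n : ℕ} (g : EuclideanSpace ℝ (Fin n) → EReal) : Prop :=
  ∃ γ : ℝ, 0 < γ ∧ ∃ x, ⊥ < moreauEnvelope g γ x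

/-- The regular (Fréchet) subdifferential: `x ∈ dom g` and
`g y ≥ g x + ⟨v, y - x⟩ - o(‖y - x‖)` as `y → x`. -/
def regularSubdiff {n : ℕ} (g : EuclideanSpace ℝ (Fin n) → EReal)
    (x : EuclideanSpace ℝ (Fin n)) : Set (EuclideanSpace ℝ (Fin n)) :=
  {v | x ∈ effDom g ∧ ∀ ε : ℝ, 0 < ε →
    ∀ᶠ y in 𝓝 x, g x + ((inner ℝ v (y - x) - ε * ‖y - x‖ : ℝ) : EReal) ≤ g y}

/-- The limiting (Mordukhovich) subdifferential; it is empty outside `dom g`. -/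
def limitingSubdiff {n : ℕ} (g : EuclideanSpace ℝ (Fin n) → EReal)
    (x : EuclideanSpace ℝ (Fin n)) : Set (EuclideanSpace ℝ (Fin n)) :=
  {v | x ∈ effDom g ∧ ∃ (y w : ℕ → EuclideanSpace ℝ (Fin n)),
    Tendsto y atTop (𝓝 x) ∧ Tendsto (fun i => g (y i)) atTop (𝓝 (g x)) ∧
    (∀ i, w i ∈ regularSubdiff g (y i)) ∧ Tendsto w atTop (𝓝 v)}

/-- The Kurdyka–Łojasiewicz property of `g` at `xs` with desingularization function `χ`,
constant `η` and neighborhood `U`. The distance from `0` to `∂g x` is taken in `[0, ∞]`, so that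
it is `∞` when `∂g x` is empty. -/
structure HasKLProperty {n : ℕ} (g : EuclideanSpace ℝ (Fin n) → EReal)
    (xs : EuclideanSpace ℝ (Fin n)) (χ : ℝ → ℝ) (η : ℝ)
    (U : Set (EuclideanSpace ℝ (Fin n))) : Prop where
  subdiff_nonempty : (limitingSubdiff g xs).Nonempty
  eta_pos : 0 < η
  nhds : U ∈ 𝓝 xs
  nonneg : ∀ t ∈ Set.Icc 0 η, 0 ≤ χ t
  continuousOn : ContinuousOn χ (Set.Icc 0 η)
  concaveOn : ConcaveOn ℝ (Set.Icc 0 η) χ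
  contDiffOn : ContDiffOn ℝ 1 χ (Set.Ioo 0 η)
  map_zero : χ 0 = 0
  deriv_pos : ∀ t ∈ Set.Ioo 0 η, 0 < deriv χ t
  kl_inequality : ∀ x ∈ U, g xs < g x → g x < g xs + (η : EReal) →
    1 ≤ ENNReal.ofReal (deriv χ ((g x).toReal - (g xs).toReal)) *
      Metric.infEDist 0 (limitingSubdiff g x)

/-! ### The composite problem and the algorithm -/

/-- The objective `F = f + φ`. -/
noncomputable def objective {n : ℕ} (f : EuclideanSpace ℝ (Fin n) → ℝ)
    (φ : EuclideanSpace ℝ (Fin n) → EReal) (x : EuclideanSpace ℝ (Fin n)) : EReal :=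
  (f x : EReal) + φ x

/-- Blanket assumptions on the problem `min f + φ`. -/
structure BlanketAssumption {n : ℕ} (f : EuclideanSpace ℝ (Fin n) → ℝ)
    (φ : EuclideanSpace ℝ (Fin n) → EReal) : Prop where
  smooth : ∃ O : Set (EuclideanSpace ℝ (Fin n)), IsOpen O ∧ effDom φ ⊆ O ∧ ContDiffOn ℝ 1 f O
  proper : IsProper φ
  lsc : LowerSemicontinuous φ
  proxBounded : ProxBounded φ
  bddBelow : ⊥ < ⨅ x, objective f φ x

/-- `∇f` is Lipschitz on a closed ball around every point of `dom φ`. -/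
def LocLipschitzGradient {n : ℕ} (f : EuclideanSpace ℝ (Fin n) → ℝ)
    (φ : EuclideanSpace ℝ (Fin n) → EReal) : Prop :=
  ∀ x ∈ effDom φ, ∃ L : ℝ, 0 < L ∧ ∃ ε : ℝ, 0 < ε ∧
    ∀ y ∈ Metric.closedBall x ε, ∀ z ∈ Metric.closedBall x ε,
      ‖gradient f y - gradient f z‖ ≤ L * ‖y - z‖

/-- The model `f(x) + ∇f(x)ᵀ(y - x) + ½ (y - x)ᵀ A (y - x) + φ(y)` around the point `x`. -/
noncomputable def quadModel {n : ℕ} (f : EuclideanSpace ℝ (Fin n) → ℝ)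
    (φ : EuclideanSpace ℝ (Fin n) → EReal) (A : Matrix (Fin n) (Fin n) ℝ)
    (x y : EuclideanSpace ℝ (Fin n)) : EReal :=
  ((f x + inner ℝ (gradient f x) (y - x)
    + 1 / 2 * inner ℝ (y - x) (Matrix.toEuclideanCLM (𝕜 := ℝ) A (y - x)) : ℝ) : EReal) + φ y

/-- `y` is a (global) minimizer of the regularized model with matrix `B + μ I`. -/
def IsSubproblemSolution {n : ℕ} (f : EuclideanSpace ℝ (Fin n) → ℝ)
    (φ : EuclideanSpace ℝ (Fin n) → EReal) (B : Matrix (Fin n) (Fin n) ℝ) (μ : ℝ)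
    (x y : EuclideanSpace ℝ (Fin n)) : Prop :=
  ∀ z, quadModel f φ (B + μ • (1 : Matrix (Fin n) (Fin n) ℝ)) x y
    ≤ quadModel f φ (B + μ • (1 : Matrix (Fin n) (Fin n) ℝ)) x z

/-- Iteration at `x` with trial point `y` is successful: `y` solves the regularized subproblem and
`ared ≥ c₁ pred`, where `ared = F x - F y` and `pred = F x - q y`, with `q` the model with
matrix `B` (all these values are finite when `x ∈ dom φ` and `y` solves the subproblem). -/
def IsAccepted {n : ℕ} (f : EuclideanSpace ℝ (Fin n) → ℝ)
    (φ : EuclideanSpace ℝ (Fin n) → EReal) (c₁ : ℝ) (B : Matrix (Fin n) (Fin n) ℝ) (μ : ℝ)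
    (x y : EuclideanSpace ℝ (Fin n)) : Prop :=
  IsSubproblemSolution f φ B μ x y ∧
    (c₁ : EReal) * (objective f φ x - quadModel f φ B x y) ≤ objective f φ x - objective f φ y

/-- The sequences `x`, `xhat`, `B`, `μ` are generated by the regularized proximal quasi-Newton
method with parameters `c₁`, `σ₂`, `μmin`, `μmax`. The trial point `xhat k` solves the `k`-th
subproblem whenever that subproblem is solvable; otherwise its value is irrelevant, since the
iteration then is unsuccessful. -/
structure IsRPQNRun {n : ℕ} (f : EuclideanSpace ℝ (Fin n) → ℝ)
    (φ : EuclideanSpace ℝ (Fin n) → EReal) (c₁ σ₂ μmin μmax : ℝ)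
    (x xhat : ℕ → EuclideanSpace ℝ (Fin n)) (B : ℕ → Matrix (Fin n) (Fin n) ℝ)
    (μ : ℕ → ℝ) : Prop where
  c₁_mem : c₁ ∈ Set.Ioo (0 : ℝ) 1
  one_lt_σ₂ : 1 < σ₂
  μmin_pos : 0 < μmin
  μmin_le_μmax : μmin ≤ μmax
  x_zero : x 0 ∈ effDom φ
  μ_zero : μ 0 ∈ Set.Icc μmin μmax
  found : ∀ k, (∃ y, IsSubproblemSolution f φ (B k) (μ k) (x k) y) →
    IsSubproblemSolution f φ (B k) (μ k) (x k) (xhat k)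
  successful : ∀ k, IsAccepted f φ c₁ (B k) (μ k) (x k) (xhat k) →
    x (k + 1) = xhat k ∧ μ (k + 1) ∈ Set.Icc μmin μmax
  unsuccessful : ∀ k, ¬ IsAccepted f φ c₁ (B k) (μ k) (x k) (xhat k) →
    x (k + 1) = x k ∧ B (k + 1) = B k ∧ μ (k + 1) = σ₂ * μ k

/-- The set of successful iterations. -/
def successfulIterations {n : ℕ} (f : EuclideanSpace ℝ (Fin n) → ℝ)
    (φ : EuclideanSpace ℝ (Fin n) → EReal) (c₁ : ℝ)
    (x xhat : ℕ → EuclideanSpace ℝ (Fin n)) (B : ℕ → Matrix (Fin n) (Fin n) ℝ)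
    (μ : ℕ → ℝ) : Set ℕ :=
  {k | IsAccepted f φ c₁ (B k) (μ k) (x k) (xhat k)}

/-! ### Rates of convergence -/

/-- Q-linear convergence `u → l`. -/
def QLinear {X : Type*} [PseudoMetricSpace X] (u : ℕ → X) (l : X) : Prop :=
  Tendsto u atTop (𝓝 l) ∧
    ∃ q ∈ Set.Ioo (0 : ℝ) 1, ∀ᶠ k in atTop, dist (u (k + 1)) l ≤ q * dist (u k) l

/-- Q-superlinear convergence `u → l` with rate (order) `p > 1`. -/
def QSuperlinear {X : Type*} [PseudoMetricSpace X] (u : ℕ → X) (l : X) (p : ℝ) : Prop :=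
  1 < p ∧ Tendsto u atTop (𝓝 l) ∧
    ∃ C : ℝ, 0 < C ∧ ∀ᶠ k in atTop, dist (u (k + 1)) l ≤ C * dist (u k) l ^ p

/-- R-linear convergence: the errors are dominated by a sequence converging Q-linearly to `0`. -/
def RLinear {X : Type*} [PseudoMetricSpace X] (u : ℕ → X) (l : X) : Prop :=
  ∃ ν : ℕ → ℝ, (∀ k, dist (u k) l ≤ ν k) ∧ QLinear ν 0

/-- R-superlinear convergence with rate `p`: the errors are dominated by a sequence converging
Q-superlinearly to `0` with rate `p`. -/
def RSuperlinear {X : Type*} [PseudoMetricSpace X] (u : ℕ → X) (l : X) (p : ℝ) : Prop :=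
  ∃ ν : ℕ → ℝ, (∀ k, dist (u k) l ≤ ν k) ∧ QSuperlinear ν 0 p

/-! ### Descent sequences satisfying a Kurdyka–Łojasiewicz estimate -/

/-! Along the successful iterates `y j`, put `r j = F (y j) - F xs`. Acceptance gives `a ‖y (j+1) -
y j‖² ≤ r j - r (j+1)`. Optimality in the subproblem gives a subgradient of `F` at `y (j+1)` of size
`O(‖y (j+1) - y j‖)`, so near `xs` the KL inequality yields `r (j+1) ^ θ ≤ b ‖y (j+1) - y j‖`.
`KLDescent` records these two facts, and they carry all the rates. Concavity of `t ^ (1 - θ)` makes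
the step lengths telescope (`step_le_lyapunov_sub`), which traps the sequence near its cluster point
and forces convergence. Squaring the second estimate gives `r (j+1) ^ (2θ) ≤ C (r j - r (j+1))`,
whose solutions decay as claimed in each range of `θ`. The distance to `xs` is `O(√r + r ^ (1 -
θ))`.

Reaching that setting needs a bound on `μ` near `xs`, although `∇f` is Lipschitz only locally.
Prox-boundedness confines the minimizers for large `μ` to a small ball, where the descent lemma
gives acceptance (`exists_threshold_accepted`). Hence `μ` and the gaps between successes are bounded
near `xs`. Finally `F (x k) → F xs`: lower semicontinuity gives one inequality, and `xs` as
competitor in the subproblems gives the other (`tendsto_value`). -/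

theorem one_sub_mul_sub_le_rpow_mul {θ u v : ℝ} (hθ : θ ∈ Set.Ioo (0 : ℝ) 1) (hu : 0 ≤ u)
    (hv : 0 ≤ v) : (1 - θ) * (u - v) ≤ u ^ θ * (u ^ (1 - θ) - v ^ (1 - θ)) := by
  -- After multiplying out, the claim is weighted AM-GM: `u^θ v^(1-θ) ≤ θ u + (1-θ) v`.
  have h := Real.geom_mean_le_arith_mean2_weighted hθ.1.le (sub_nonneg.2 hθ.2.le) hu hv (by ring)
  have h2 : u ^ θ * u ^ (1 - θ) = u := by
    rw [← Real.rpow_add_of_nonneg hu hθ.1.le (sub_nonneg.2 hθ.2.le)]; simp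
  rw [mul_sub (u ^ θ), h2]; linarith

/-- A sequence `y` with sufficient decrease of the values `r` and a Kurdyka–Łojasiewicz type
relative error bound near the cluster point `xs`. -/
structure KLDescent {E : Type*} [NormedAddCommGroup E] (y : ℕ → E) (r : ℕ → ℝ) (xs : E)
    (a b θ ρ : ℝ) : Prop where
  a_pos : 0 < a
  b_pos : 0 < b
  θ_mem : θ ∈ Set.Ioo (0 : ℝ) 1
  ρ_pos : 0 < ρ
  nonneg : ∀ j, 0 ≤ r j
  descent : ∀ j, a * ‖y (j + 1) - y j‖ ^ 2 ≤ r j - r (j + 1)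
  tendsto_zero : Tendsto r atTop (𝓝 0)
  relative_error : ∀ᶠ j in atTop, ‖y j - xs‖ < ρ → ‖y (j + 1) - xs‖ < ρ →
    r (j + 1) ^ θ ≤ b * ‖y (j + 1) - y j‖
  cluster : MapClusterPt xs atTop y

namespace KLDescent

variable {E : Type*} [NormedAddCommGroup E] {y : ℕ → E} {r : ℕ → ℝ} {xs : E} {a b θ ρ : ℝ}

theorem antitone (h : KLDescent y r xs a b θ ρ) : Antitone r :=
  antitone_nat_of_succ_le fun j => by
    have := h.descent j
    have := mul_nonneg h.a_pos.le (sq_nonneg ‖y (j + 1) - y j‖)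
    linarith

theorem step_le_sqrt (h : KLDescent y r xs a b θ ρ) (j : ℕ) :
    ‖y (j + 1) - y j‖ ≤ √(1 / a) * √(r j) := by
  have ha := h.a_pos
  rw [← Real.sqrt_mul (by positivity)]
  apply Real.le_sqrt_of_sq_le
  have h1 := h.descent j
  have h2 := h.nonneg (j + 1)
  rw [one_div, inv_mul_eq_div, le_div_iff₀ ha]
  linarith

theorem tendsto_step (h : KLDescent y r xs a b θ ρ) :
    Tendsto (fun j => ‖y (j + 1) - y j‖) atTop (𝓝 0) := by
  have h1 : Tendsto (fun j => √(1 / a) * √(r j)) atTop (𝓝 0) := by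
    simpa using (h.tendsto_zero.sqrt).const_mul (√(1 / a))
  exact squeeze_zero (fun _ => norm_nonneg _) h.step_le_sqrt h1

/-- The Lyapunov function controlling the remaining length of the trajectory. -/
noncomputable def lyapunov (y : ℕ → E) (r : ℕ → ℝ) (a b θ : ℝ) (k : ℕ) : ℝ :=
  ‖y (k + 1) - y k‖ + b / (a * (1 - θ)) * r (k + 1) ^ (1 - θ)

theorem lyapunov_nonneg (h : KLDescent y r xs a b θ ρ) (k : ℕ) : 0 ≤ lyapunov y r a b θ k := by
  have := h.a_pos
  have := h.b_pos
  have := sub_pos.2 h.θ_mem.2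
  have := h.nonneg (k + 1)
  unfold lyapunov
  positivity

theorem tendsto_lyapunov (h : KLDescent y r xs a b θ ρ) :
    Tendsto (lyapunov y r a b θ) atTop (𝓝 0) := by
  have hθ := sub_pos.2 h.θ_mem.2
  have h1 : Tendsto (fun k => r (k + 1) ^ (1 - θ)) atTop (𝓝 0) := by
    have := ((tendsto_add_atTop_iff_nat 1).2 h.tendsto_zero).rpow_const
      (p := 1 - θ) (Or.inr hθ.le)
    rwa [Real.zero_rpow hθ.ne'] at this
  unfold lyapunov
  simpa using h.tendsto_step.add (h1.const_mul (b / (a * (1 - θ))))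

/-- With `d`, `e` consecutive step lengths and `q` the scaled drop of `r ^ (1 - θ)`, descent and
concavity give `e² ≤ d q`, hence `2 e ≤ d + q`. This rearranges to `e ≤ (d - e) + q`, and the
right-hand side telescopes. -/
theorem step_le_lyapunov_sub (h : KLDescent y r xs a b θ ρ) {k : ℕ}
    (hk : r (k + 1) ^ θ ≤ b * ‖y (k + 1) - y k‖) :
    ‖y (k + 2) - y (k + 1)‖ ≤ lyapunov y r a b θ k - lyapunov y r a b θ (k + 1) := by
  have ha := h.a_pos
  have hb := h.b_pos
  have hθ := sub_pos.2 h.θ_mem.2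
  have h1 := one_sub_mul_sub_le_rpow_mul h.θ_mem (h.nonneg (k + 1)) (h.nonneg (k + 2))
  have h2 := h.descent (k + 1)
  have hΔ : 0 ≤ r (k + 1) ^ (1 - θ) - r (k + 2) ^ (1 - θ) :=
    sub_nonneg.2 (Real.rpow_le_rpow (h.nonneg _) (h.antitone (by omega)) hθ.le)
  have h3 := mul_le_mul_of_nonneg_right hk hΔ
  unfold lyapunov
  simp only [show k + 1 + 1 = k + 2 from rfl] at *
  set d := ‖y (k + 1) - y k‖
  set e := ‖y (k + 2) - y (k + 1)‖
  set Δ := r (k + 1) ^ (1 - θ) - r (k + 2) ^ (1 - θ) with hΔdef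
  have hd : 0 ≤ d := norm_nonneg _
  have hκ : 0 < b / (a * (1 - θ)) := by positivity
  have h4 : e ^ 2 ≤ d * (b / (a * (1 - θ)) * Δ) := by
    have : d * (b / (a * (1 - θ)) * Δ) = (b * d * Δ) / (a * (1 - θ)) := by
      field_simp
    rw [this, le_div_iff₀ (by positivity)]
    have := mul_le_mul_of_nonneg_left h2 hθ.le
    linarith
  set q := b / (a * (1 - θ)) * Δ with hq
  have hq0 : 0 ≤ q := mul_nonneg hκ.le hΔ
  have h5 : 2 * e ≤ d + q := by
    apply abs_le_of_sq_le_sq' _ (by positivity) |>.2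
    nlinarith [sq_nonneg (d - q)]
  have h6 : q = b / (a * (1 - θ)) * r (k + 1) ^ (1 - θ)
      - b / (a * (1 - θ)) * r (k + 2) ^ (1 - θ) := by rw [hq, hΔdef]; ring
  linarith

theorem norm_sub_le_lyapunov_sub (h : KLDescent y r xs a b θ ρ) {K k : ℕ}
    (hK : ∀ j, K ≤ j → r (j + 1) ^ θ ≤ b * ‖y (j + 1) - y j‖) (hk : K ≤ k) (i : ℕ) :
    ‖y (k + i + 1) - y (k + 1)‖ ≤ lyapunov y r a b θ k - lyapunov y r a b θ (k + i) := by
  induction i with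
  | zero => simp
  | succ i ih =>
    have h1 := h.step_le_lyapunov_sub (hK (k + i) (by omega))
    have h2 := norm_sub_le_norm_sub_add_norm_sub (y (k + i + 2)) (y (k + i + 1)) (y (k + 1))
    rw [show k + (i + 1) = k + i + 1 by ring]
    linarith

/-- The trapping argument. Start at a late index `k` with `‖y k - xs‖`, the step and the Lyapunov
value all below `ρ / 3`. Every later iterate then stays within the remaining Lyapunov budget of `y
(k + 1)`, so it never leaves the `ρ`-ball and the local error bound holds at every later index. -/
theorem eventually_relative_error (h : KLDescent y r xs a b θ ρ) :
    ∃ K, ∀ j, K ≤ j → r (j + 1) ^ θ ≤ b * ‖y (j + 1) - y j‖ := by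
  have hρ : 0 < ρ / 3 := by linarith [h.ρ_pos]
  have hev := (h.relative_error.and (h.tendsto_step.eventually_lt_const hρ)).and
    (h.tendsto_lyapunov.eventually_lt_const hρ)
  obtain ⟨N, hN⟩ := eventually_atTop.1 hev
  have hfr : ∃ᶠ k in atTop, ‖y k - xs‖ < ρ / 3 := by
    have := h.cluster.frequently (Metric.ball_mem_nhds xs hρ)
    simpa [Metric.mem_ball, dist_eq_norm] using this
  obtain ⟨k, hkN, hk⟩ := (frequently_atTop.1 hfr) N
  obtain ⟨⟨-, hk2⟩, hk3⟩ := hN k hkN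
  have key : ∀ i, ‖y (k + i) - xs‖ < ρ ∧ ‖y (k + i + 1) - xs‖ < ρ ∧
      ‖y (k + i + 1) - y (k + 1)‖ ≤ lyapunov y r a b θ k - lyapunov y r a b θ (k + i) := by
    intro i
    have h1 := norm_sub_le_norm_sub_add_norm_sub (y (k + 1)) (y k) xs
    induction i with
    | zero =>
      refine ⟨by simp only [add_zero]; linarith [h.ρ_pos], ?_, by simp⟩
      simp only [add_zero]; linarith [h.ρ_pos]
    | succ i ih =>
      obtain ⟨i1, i2, i3⟩ := ih
      have h4 := h.step_le_lyapunov_sub ((hN (k + i) (by omega)).1.1 i1 i2)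
      have h5 := norm_sub_le_norm_sub_add_norm_sub (y (k + i + 2)) (y (k + i + 1)) (y (k + 1))
      have h6 := norm_sub_le_norm_sub_add_norm_sub (y (k + i + 2)) (y (k + 1)) xs
      have h7 := h.lyapunov_nonneg (k + i + 1)
      rw [show k + (i + 1) = k + i + 1 by ring]
      exact ⟨i2, by rw [show k + i + 1 + 1 = k + i + 2 by ring]; linarith, by
        rw [show k + i + 1 + 1 = k + i + 2 by ring]; linarith⟩
  refine ⟨k, fun j hj => ?_⟩
  obtain ⟨i, rfl⟩ := Nat.exists_eq_add_of_le hj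
  exact (hN (k + i) (by omega)).1.1 (key i).1 (key i).2.1

/-- The same three-thirds budget with an arbitrary `ε`; the error bound no longer depends on being
near `xs`. -/
theorem tendsto (h : KLDescent y r xs a b θ ρ) : Tendsto y atTop (𝓝 xs) := by
  obtain ⟨K, hK⟩ := h.eventually_relative_error
  rw [Metric.tendsto_atTop]
  intro ε hε
  have hε3 : 0 < ε / 3 := by linarith
  obtain ⟨N, hN⟩ := eventually_atTop.1 ((h.tendsto_step.eventually_lt_const hε3).and
    (h.tendsto_lyapunov.eventually_lt_const hε3))
  have hfr : ∃ᶠ k in atTop, ‖y k - xs‖ < ε / 3 := by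
    have := h.cluster.frequently (Metric.ball_mem_nhds xs hε3)
    simpa [Metric.mem_ball, dist_eq_norm] using this
  obtain ⟨k, hkN, hk⟩ := (frequently_atTop.1 hfr) (max N K)
  obtain ⟨hk1, hk2⟩ := hN k (le_trans (le_max_left _ _) hkN)
  refine ⟨k + 1, fun m hm => ?_⟩
  obtain ⟨i, rfl⟩ := Nat.exists_eq_add_of_le hm
  have h1 := h.norm_sub_le_lyapunov_sub hK (le_trans (le_max_right _ _) hkN) i
  have h2 := h.lyapunov_nonneg (k + i)
  have h3 := norm_sub_le_norm_sub_add_norm_sub (y (k + i + 1)) (y (k + 1)) xs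
  have h4 := norm_sub_le_norm_sub_add_norm_sub (y (k + 1)) (y k) xs
  rw [dist_eq_norm, show k + 1 + i = k + i + 1 by ring]
  linarith

theorem eventually_norm_sub_le (h : KLDescent y r xs a b θ ρ) :
    ∃ C, 0 < C ∧ ∀ᶠ k in atTop, ‖y k - xs‖ ≤ C * (√(r k) + r k ^ (1 - θ)) := by
  obtain ⟨K, hK⟩ := h.eventually_relative_error
  have ha := h.a_pos
  have hb := h.b_pos
  have hθ := sub_pos.2 h.θ_mem.2
  have hκ : 0 < b / (a * (1 - θ)) := by positivity
  -- One `√(1 / a)` pays for the step from `y k` to `y (k + 1)`, the other for the step term in the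
  -- Lyapunov function, which bounds the rest of the trajectory.
  refine ⟨2 * √(1 / a) + b / (a * (1 - θ)), by positivity, eventually_atTop.2 ⟨K, fun k hk => ?_⟩⟩
  have h1 : ‖xs - y (k + 1)‖ ≤ lyapunov y r a b θ k := by
    have ht : Tendsto (fun i => ‖y (k + i + 1) - y (k + 1)‖) atTop (𝓝 ‖xs - y (k + 1)‖) := by
      have h2 : Tendsto (fun i => k + i + 1) atTop atTop :=
        tendsto_atTop_mono (fun i => show i ≤ k + i + 1 by omega) tendsto_id
      exact ((h.tendsto.comp h2).sub_const _).norm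
    refine le_of_tendsto ht (Eventually.of_forall fun i => ?_)
    have h1 := h.norm_sub_le_lyapunov_sub hK hk i
    have h2 := h.lyapunov_nonneg (k + i)
    linarith
  have h2 := norm_sub_le_norm_sub_add_norm_sub (y k) (y (k + 1)) xs
  rw [norm_sub_rev (y k) (y (k + 1)), norm_sub_rev (y (k + 1)) xs] at h2
  have h3 := h.step_le_sqrt k
  have h4 : r (k + 1) ^ (1 - θ) ≤ r k ^ (1 - θ) :=
    Real.rpow_le_rpow (h.nonneg _) (h.antitone (by omega)) hθ.le
  have h5 := mul_le_mul_of_nonneg_left h4 hκ.le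
  have h6 : 0 ≤ √(1 / a) * r k ^ (1 - θ) :=
    mul_nonneg (Real.sqrt_nonneg _) (Real.rpow_nonneg (h.nonneg _) _)
  have h7 : 0 ≤ b / (a * (1 - θ)) * √(r k) := by positivity
  unfold lyapunov at h1
  linarith

/-- Square the relative error bound and insert the descent estimate. All rates for the values follow
from this recursion. -/
theorem eventually_rpow_le (h : KLDescent y r xs a b θ ρ) :
    ∃ C, 0 < C ∧ ∀ᶠ k in atTop, r (k + 1) ^ (2 * θ) ≤ C * (r k - r (k + 1)) := by
  obtain ⟨K, hK⟩ := h.eventually_relative_error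
  have ha := h.a_pos
  have hb := h.b_pos
  refine ⟨b ^ 2 / a, by positivity, eventually_atTop.2 ⟨K, fun k hk => ?_⟩⟩
  have h1 := hK k hk
  have h2 := pow_le_pow_left₀ (Real.rpow_nonneg (h.nonneg (k + 1)) θ) h1 2
  have h3 : r (k + 1) ^ (2 * θ) = (r (k + 1) ^ θ) ^ 2 := by
    rw [mul_comm, Real.rpow_mul (h.nonneg _)]; norm_cast
  have h4 := mul_le_mul_of_nonneg_left (h.descent k) (sq_nonneg b)
  rw [h3, div_mul_eq_mul_div, le_div_iff₀ ha]
  nlinarith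

theorem eventually_norm_sub_le_sqrt (h : KLDescent y r xs a b θ ρ) (hθ : θ ≤ 1 / 2) :
    ∃ C, 0 < C ∧ ∀ᶠ k in atTop, ‖y k - xs‖ ≤ C * √(r k) := by
  obtain ⟨C, hC, hev⟩ := h.eventually_norm_sub_le
  refine ⟨2 * C, by positivity, ?_⟩
  filter_upwards [hev, h.tendsto_zero.eventually_le_const one_pos] with k hk hk1
  have h1 : r k ^ (1 - θ) ≤ √(r k) := by
    rw [Real.sqrt_eq_rpow]
    exact Real.rpow_le_rpow_of_exponent_ge_of_imp (h.nonneg k) hk1 (by linarith)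
      (fun _ h0 => absurd h0 (sub_pos.2 h.θ_mem.2).ne')
  nlinarith

theorem eventually_norm_sub_le_rpow (h : KLDescent y r xs a b θ ρ) (hθ : 1 / 2 ≤ θ) :
    ∃ C, 0 < C ∧ ∀ᶠ k in atTop, ‖y k - xs‖ ≤ C * r k ^ (1 - θ) := by
  obtain ⟨C, hC, hev⟩ := h.eventually_norm_sub_le
  refine ⟨2 * C, by positivity, ?_⟩
  filter_upwards [hev, h.tendsto_zero.eventually_le_const one_pos] with k hk hk1
  have h1 : √(r k) ≤ r k ^ (1 - θ) := by
    rw [Real.sqrt_eq_rpow]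
    exact Real.rpow_le_rpow_of_exponent_ge_of_imp (h.nonneg k) hk1 (by linarith)
      (fun _ h0 => by norm_num at h0)
  nlinarith

theorem eventually_le_mul_rpow (h : KLDescent y r xs a b θ ρ) :
    ∃ C, 0 < C ∧ ∀ᶠ k in atTop, r (k + 1) ≤ C * r k ^ (1 / (2 * θ)) := by
  obtain ⟨C, hC, hev⟩ := h.eventually_rpow_le
  have hθ := h.θ_mem.1
  refine ⟨C ^ (1 / (2 * θ)), by positivity, hev.mono fun k hk => ?_⟩
  have h0 := h.nonneg (k + 1)
  have h1 : r (k + 1) ^ (2 * θ) ≤ C * r k := by nlinarith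
  have h2 := Real.rpow_le_rpow (by positivity) h1 (z := 1 / (2 * θ)) (by positivity)
  rwa [← Real.rpow_mul h0, mul_one_div_cancel (by positivity), Real.rpow_one,
    Real.mul_rpow hC.le (h.nonneg k)] at h2

theorem eventually_le_mul (h : KLDescent y r xs a b θ ρ) (hθ : θ = 1 / 2) :
    ∃ q ∈ Set.Ioo (0 : ℝ) 1, ∀ᶠ k in atTop, r (k + 1) ≤ q * r k := by
  obtain ⟨C, hC, hev⟩ := h.eventually_rpow_le
  refine ⟨C / (1 + C), ⟨by positivity, by rw [div_lt_one (by positivity)]; linarith⟩,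
    hev.mono fun k hk => ?_⟩
  rw [hθ, show (2 : ℝ) * (1 / 2) = 1 by norm_num, Real.rpow_one] at hk
  rw [div_mul_eq_mul_div, le_div_iff₀ (by positivity)]
  linarith

end KLDescent

/-! ### Sublinear decay from a difference inequality -/

theorem one_sub_div_le_rpow_neg {α t : ℝ} (hα : 0 ≤ α) (ht : 0 < t) :
    t ^ (-α) * (1 - α / t) ≤ (t + 1) ^ (-α) := by
  have h1 : t + 1 = t * (1 + 1 / t) := by field_simp
  have h2 : (0 : ℝ) < 1 + 1 / t := by positivity
  rw [h1, Real.mul_rpow ht.le h2.le]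
  refine mul_le_mul_of_nonneg_left ?_ (by positivity)
  rw [Real.rpow_def_of_pos h2]
  -- Bernoulli for a negative exponent, from `exp s ≥ 1 + s` and `log (1 + 1/t) ≤ 1/t`.
  have h3 := Real.add_one_le_exp (Real.log (1 + 1 / t) * -α)
  have h4 := Real.log_le_sub_one_of_pos h2
  have h5 : α / t = α * (1 / t) := by ring
  nlinarith [mul_le_mul_of_nonneg_left h4 hα]

/-- Sublinear decay of a nonnegative sequence satisfying `r_{k+1} ^ p ≤ C (r_k - r_{k+1})`. -/
theorem eventually_le_rpow_neg_of_rpow_le {r : ℕ → ℝ} {p C : ℝ} (hp : 1 < p) (hC : 0 < C)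
    (hr : ∀ k, 0 ≤ r k) (h : ∀ᶠ k in atTop, r (k + 1) ^ p ≤ C * (r k - r (k + 1))) :
    ∃ D, 0 < D ∧ ∀ᶠ k : ℕ in atTop, r k ≤ D * (k : ℝ) ^ (-(1 / (p - 1))) := by
  obtain ⟨K₀, hK₀⟩ := eventually_atTop.1 h
  set K := K₀ + 1 with hK
  have hp1 : 0 < p - 1 := by linarith
  set α := 1 / (p - 1) with hα
  have hα0 : 0 < α := by positivity
  have hαp : α * p = α + 1 := by rw [hα]; field_simp; ring
  have hαp1 : α * (p - 1) = 1 := by rw [hα]; field_simp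
  have hKpos : (0 : ℝ) < K := by rw [hK]; positivity
  set D₁ := r K * (K : ℝ) ^ α
  -- The factor `2 ^ (α + 1)` pays for replacing `k` by `k + 1`, since `1/k ≤ 2/(k+1)`. In `D`
  -- below, `D₁` serves the base case and `Q ^ α` ensures `Q ≤ D ^ (p - 1)` for the induction step.
  set Q := C * α * 2 ^ (α + 1) with hQ
  have hQ0 : 0 < Q := by positivity
  set D := D₁ + Q ^ α with hD
  have hD₁ : 0 ≤ D₁ := mul_nonneg (hr K) (by positivity)
  have hQα : 0 < Q ^ α := by positivity
  have hDpos : 0 < D := by positivity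
  have hDQ : Q ≤ D ^ (p - 1) := by
    have : (Q ^ α) ^ (p - 1) ≤ D ^ (p - 1) :=
      Real.rpow_le_rpow hQα.le (by linarith) hp1.le
    rwa [← Real.rpow_mul hQ0.le, hαp1, Real.rpow_one] at this
  refine ⟨D, hDpos, eventually_atTop.2 ⟨K, fun k hk => ?_⟩⟩
  induction k, hk using Nat.le_induction with
  | base =>
    rw [Real.rpow_neg hKpos.le, ← div_eq_mul_inv, le_div_iff₀ (by positivity)]
    linarith
  | succ k hk ih =>
    -- If `r (k + 1)` were too large, the recursion would force a drop `r k - r (k + 1) > D α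
    -- k^(-(α+1))`. That is at least the decrease of `D k^(-α)` over one step, so `r (k + 1)` would
    -- lie below the bound after all.
    by_contra! hcon
    have hk0 : (0 : ℝ) < k := lt_of_lt_of_le hKpos (by exact_mod_cast hk)
    have hk1 : (1 : ℝ) ≤ k := by
      have : 1 ≤ k := by omega
      exact_mod_cast this
    push_cast at hcon
    have h1 := hK₀ k (by omega)
    have hpos : 0 < D * ((k : ℝ) + 1) ^ (-α) := by positivity
    have h2 : (D * ((k : ℝ) + 1) ^ (-α)) ^ p < r (k + 1) ^ p :=
      Real.rpow_lt_rpow hpos.le hcon (by linarith)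
    rw [Real.mul_rpow hDpos.le (by positivity), ← Real.rpow_mul (by positivity), neg_mul,
      hαp] at h2
    have h3 := one_sub_div_le_rpow_neg hα0.le hk0
    have h4 : (k : ℝ) ^ (-α) * (α / k) = α * (k : ℝ) ^ (-(α + 1)) := by
      rw [neg_add, Real.rpow_add hk0, Real.rpow_neg_one]; ring
    have h5 : (k : ℝ) ^ (-(α + 1)) ≤ 2 ^ (α + 1) * ((k : ℝ) + 1) ^ (-(α + 1)) := by
      rw [Real.rpow_neg hk0.le, Real.rpow_neg (by positivity), ← div_eq_mul_inv,
        ← Real.div_rpow (by norm_num) (by positivity), ← Real.inv_rpow hk0.le]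
      refine Real.rpow_le_rpow (by positivity) ?_ (by positivity)
      rw [inv_eq_one_div, div_le_div_iff₀ hk0 (by positivity)]
      linarith
    have h6 : D ^ p = D * D ^ (p - 1) := by
      rw [← Real.rpow_one_add' hDpos.le (by linarith)]; ring_nf
    have h7 : D * Q * ((k : ℝ) + 1) ^ (-(α + 1)) ≤ D ^ p * ((k : ℝ) + 1) ^ (-(α + 1)) := by
      rw [h6]; gcongr
    have h8 : D * α * (k : ℝ) ^ (-(α + 1)) * C ≤ D * Q * ((k : ℝ) + 1) ^ (-(α + 1)) := by
      have := mul_le_mul_of_nonneg_left h5 (by positivity : 0 ≤ D * α * C)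
      calc D * α * (k : ℝ) ^ (-(α + 1)) * C = D * α * C * (k : ℝ) ^ (-(α + 1)) := by ring
        _ ≤ _ := this
        _ = _ := by rw [hQ]; ring
    have h9 : D * α * (k : ℝ) ^ (-(α + 1)) < r k - r (k + 1) := by
      have : C * (D * α * (k : ℝ) ^ (-(α + 1))) < C * (r k - r (k + 1)) := by linarith
      exact lt_of_mul_lt_mul_left this hC.le
    have h10 : D * (k : ℝ) ^ (-α) - D * α * (k : ℝ) ^ (-(α + 1)) ≤ D * ((k : ℝ) + 1) ^ (-α) := by
      have := mul_le_mul_of_nonneg_left h3 hDpos.le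
      rw [mul_sub, h4] at this
      linarith
    linarith

/-- If the errors are eventually dominated by `ν`, then they are dominated everywhere by a sequence
that eventually equals `ν`. -/
theorem exists_dominating_of_eventually {X : Type*} [PseudoMetricSpace X] {u : ℕ → X} {l : X}
    {ν : ℕ → ℝ} (h : ∀ᶠ k in atTop, dist (u k) l ≤ ν k) :
    ∃ ν' : ℕ → ℝ, (∀ k, dist (u k) l ≤ ν' k) ∧ ν' =ᶠ[atTop] ν :=
  ⟨fun k => max (dist (u k) l) (ν k), fun _ => le_max_left _ _, h.mono fun _ hk => max_eq_right hk⟩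

theorem QLinear.congr' {X : Type*} [PseudoMetricSpace X] {u v : ℕ → X} {l : X} (hu : QLinear u l)
    (h : v =ᶠ[atTop] u) : QLinear v l := by
  obtain ⟨h1, q, hq, h2⟩ := hu
  refine ⟨h1.congr' h.symm, q, hq, ?_⟩
  filter_upwards [h2, h, (tendsto_add_atTop_nat 1).eventually h] with k h3 h4 h5
  rwa [h4, h5]

theorem QSuperlinear.congr' {X : Type*} [PseudoMetricSpace X] {u v : ℕ → X} {l : X} {p : ℝ}
    (hu : QSuperlinear u l p) (h : v =ᶠ[atTop] u) : QSuperlinear v l p := by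
  obtain ⟨h0, h1, q, hq, h2⟩ := hu
  refine ⟨h0, h1.congr' h.symm, q, hq, ?_⟩
  filter_upwards [h2, h, (tendsto_add_atTop_nat 1).eventually h] with k h3 h4 h5
  rwa [h4, h5]

namespace KLDescent

variable {E : Type*} [NormedAddCommGroup E] {y : ℕ → E} {r : ℕ → ℝ} {xs : E} {a b θ ρ : ℝ}

theorem qSuperlinear (h : KLDescent y r xs a b θ ρ) (hθ : θ < 1 / 2) :
    QSuperlinear r 0 (1 / (2 * θ)) := by
  have h0 := h.θ_mem.1
  obtain ⟨C, hC, hev⟩ := h.eventually_le_mul_rpow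
  refine ⟨by rw [lt_div_iff₀ (by positivity)]; linarith, h.tendsto_zero, C, hC,
    hev.mono fun k hk => ?_⟩
  simpa [abs_of_nonneg (h.nonneg _)] using hk

theorem rSuperlinear (h : KLDescent y r xs a b θ ρ) (hθ : θ < 1 / 2) :
    RSuperlinear y xs (1 / (2 * θ)) := by
  have h0 := h.θ_mem.1
  obtain ⟨D, hD, hdom⟩ := h.eventually_norm_sub_le_sqrt hθ.le
  obtain ⟨ν, hν, heq⟩ := exists_dominating_of_eventually (u := y) (l := xs)
    (ν := fun k => D * √(r k)) (hdom.mono fun k hk => by rwa [dist_eq_norm])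
  refine ⟨ν, hν, QSuperlinear.congr' ⟨(h.qSuperlinear hθ).1, ?_, ?_⟩ heq⟩
  · simpa using (h.tendsto_zero.sqrt).const_mul D
  obtain ⟨C, hC, hev⟩ := h.eventually_le_mul_rpow
  set p := 1 / (2 * θ)
  -- Taking roots preserves the order `p`; rescaling the sequence by `D` multiplies the constant by
  -- `D / D ^ p`.
  refine ⟨D * √C / D ^ p, by positivity, hev.mono fun k hk => ?_⟩
  have h1 : √(r (k + 1)) ≤ √C * √(r k) ^ p := by
    refine (Real.sqrt_le_sqrt hk).trans (le_of_eq ?_)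
    rw [Real.sqrt_mul hC.le, Real.sqrt_eq_rpow (r k ^ p), Real.sqrt_eq_rpow (r k),
      ← Real.rpow_mul (h.nonneg k), ← Real.rpow_mul (h.nonneg k), mul_comm p]
  rw [Real.dist_0_eq_abs, Real.dist_0_eq_abs, abs_of_nonneg (by positivity),
    abs_of_nonneg (by positivity), Real.mul_rpow hD.le (by positivity)]
  have h2 : D * √C / D ^ p * (D ^ p * √(r k) ^ p) = D * (√C * √(r k) ^ p) := by
    field_simp
  rw [h2]
  gcongr

theorem qLinear (h : KLDescent y r xs a b θ ρ) (hθ : θ = 1 / 2) : QLinear r 0 := by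
  obtain ⟨q, hq, hev⟩ := h.eventually_le_mul hθ
  refine ⟨h.tendsto_zero, q, hq, hev.mono fun k hk => ?_⟩
  simpa [abs_of_nonneg (h.nonneg _)] using hk

theorem rLinear (h : KLDescent y r xs a b θ ρ) (hθ : θ = 1 / 2) : RLinear y xs := by
  obtain ⟨D, hD, hdom⟩ := h.eventually_norm_sub_le_sqrt hθ.le
  obtain ⟨ν, hν, heq⟩ := exists_dominating_of_eventually (u := y) (l := xs)
    (ν := fun k => D * √(r k)) (hdom.mono fun k hk => by rwa [dist_eq_norm])
  refine ⟨ν, hν, QLinear.congr' ⟨?_, ?_⟩ heq⟩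
  · simpa using (h.tendsto_zero.sqrt).const_mul D
  obtain ⟨q, hq, hev⟩ := h.eventually_le_mul hθ
  refine ⟨√q, ⟨Real.sqrt_pos.2 hq.1, by rw [Real.sqrt_lt' one_pos]; linarith [hq.2]⟩,
    hev.mono fun k hk => ?_⟩
  rw [Real.dist_0_eq_abs, Real.dist_0_eq_abs, abs_of_nonneg (by positivity),
    abs_of_nonneg (by positivity)]
  have h1 := Real.sqrt_le_sqrt hk
  rw [Real.sqrt_mul hq.1.le] at h1
  calc D * √(r (k + 1)) ≤ D * (√q * √(r k)) := by gcongr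
    _ = _ := by ring

theorem sublinear (h : KLDescent y r xs a b θ ρ) (hθ : 1 / 2 < θ) :
    ∃ C₁ C₂ : ℝ, 0 < C₁ ∧ 0 < C₂ ∧ ∀ᶠ k : ℕ in atTop,
      r k ≤ C₁ * (k : ℝ) ^ (-(1 / (2 * θ - 1))) ∧
      ‖y k - xs‖ ≤ C₂ * (k : ℝ) ^ (-((1 - θ) / (2 * θ - 1))) := by
  have h1θ := sub_pos.2 h.θ_mem.2
  obtain ⟨C, hC, hev⟩ := h.eventually_rpow_le
  obtain ⟨D, hD, hr⟩ := eventually_le_rpow_neg_of_rpow_le (by linarith) hC h.nonneg hev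
  obtain ⟨C', hC', hy⟩ := h.eventually_norm_sub_le_rpow hθ.le
  refine ⟨D, C' * D ^ (1 - θ), hD, by positivity, ?_⟩
  filter_upwards [hr, hy] with k h1 h2
  refine ⟨h1, h2.trans ?_⟩
  have h3 := Real.rpow_le_rpow (h.nonneg k) h1 h1θ.le
  rw [Real.mul_rpow hD.le (by positivity), ← Real.rpow_mul (by positivity)] at h3
  rw [mul_assoc]
  refine mul_le_mul_of_nonneg_left (h3.trans (le_of_eq ?_)) hC'.le
  congr 2
  ring

end KLDescent

/-! ### The regularized quadratic model -/

section Model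

variable {n : ℕ} {f : EuclideanSpace ℝ (Fin n) → ℝ} {φ : EuclideanSpace ℝ (Fin n) → EReal}
  {B : Matrix (Fin n) (Fin n) ℝ} {μ : ℝ} {x y z : EuclideanSpace ℝ (Fin n)}

/-- The quadratic `⟨g, d⟩ + ½ ⟨d, T d⟩ + ½ μ ‖d‖²`. -/
noncomputable def regQuadratic {E : Type*} [NormedAddCommGroup E] [InnerProductSpace ℝ E]
    (g : E) (T : E →L[ℝ] E) (μ : ℝ) (d : E) : ℝ :=
  inner ℝ g d + 1 / 2 * inner ℝ d (T d) + μ / 2 * ‖d‖ ^ 2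

section RegQuadratic

variable {E : Type*} [NormedAddCommGroup E] [InnerProductSpace ℝ E]

@[simp]
theorem regQuadratic_apply_zero (g : E) (T : E →L[ℝ] E) (μ : ℝ) : regQuadratic g T μ 0 = 0 := by
  simp [regQuadratic]

theorem regQuadratic_eq_add (g : E) (T : E →L[ℝ] E) (μ : ℝ) (d : E) :
    regQuadratic g T μ d = regQuadratic g T 0 d + μ / 2 * ‖d‖ ^ 2 := by
  simp [regQuadratic]

theorem abs_inner_apply_le {T : E →L[ℝ] E} {M : ℝ} (hT : ‖T‖ ≤ M) (d : E) :
    |inner ℝ d (T d)| ≤ M * ‖d‖ ^ 2 := by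
  have h1 := abs_real_inner_le_norm d (T d)
  have h2 := T.le_of_opNorm_le hT d
  nlinarith [mul_le_mul_of_nonneg_left h2 (norm_nonneg d)]

theorem le_regQuadratic {g : E} {T : E →L[ℝ] E} {G M : ℝ} (hg : ‖g‖ ≤ G) (hT : ‖T‖ ≤ M) (μ : ℝ)
    (d : E) : -(G * ‖d‖) + (μ - M) / 2 * ‖d‖ ^ 2 ≤ regQuadratic g T μ d := by
  have h1 := (abs_le.1 (abs_real_inner_le_norm g d)).1
  have h2 := (abs_le.1 (abs_inner_apply_le hT d)).1
  have h3 := mul_le_mul_of_nonneg_right hg (norm_nonneg d)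
  unfold regQuadratic
  linarith

theorem regQuadratic_le {g : E} {T : E →L[ℝ] E} {G M : ℝ} (hg : ‖g‖ ≤ G) (hT : ‖T‖ ≤ M) (μ : ℝ)
    (d : E) : regQuadratic g T μ d ≤ G * ‖d‖ + (μ + M) / 2 * ‖d‖ ^ 2 := by
  have h1 := (abs_le.1 (abs_real_inner_le_norm g d)).2
  have h2 := (abs_le.1 (abs_inner_apply_le hT d)).2
  have h3 := mul_le_mul_of_nonneg_right hg (norm_nonneg d)
  unfold regQuadratic
  linarith

theorem continuous_regQuadratic (g : E) (T : E →L[ℝ] E) (μ : ℝ) :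
    Continuous (regQuadratic g T μ) := by
  unfold regQuadratic
  fun_prop

/-- The gradient of `regQuadratic g T μ` at `d`. -/
noncomputable def regQuadraticGradient [CompleteSpace E] (g : E) (T : E →L[ℝ] E) (μ : ℝ) (d : E) :
    E :=
  g + (1 / 2 : ℝ) • (T d + ContinuousLinearMap.adjoint T d) + μ • d

/-- The expansion is exact, with the pure quadratic as remainder. Since `B` need not be symmetric,
the adjoint enters the gradient. -/
theorem regQuadratic_add [CompleteSpace E] (g : E) (T : E →L[ℝ] E) (μ : ℝ) (d w : E) :
    regQuadratic g T μ (d + w) = regQuadratic g T μ d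
      + inner ℝ (regQuadraticGradient g T μ d) w + regQuadratic 0 T μ w := by
  unfold regQuadratic regQuadraticGradient
  rw [norm_add_sq_real, map_add]
  simp only [inner_add_left, inner_add_right, inner_smul_left, inner_zero_left,
    ContinuousLinearMap.adjoint_inner_left, RCLike.conj_to_real]
  rw [real_inner_comm w (T d)]
  ring

end RegQuadratic

theorem coe_toReal_of_mem_effDom (hbot : φ y ≠ ⊥) (hy : y ∈ effDom φ) :
    (((φ y).toReal : ℝ) : EReal) = φ y :=
  EReal.coe_toReal (ne_of_lt hy) hbot

theorem objective_eq_coe (hbot : φ y ≠ ⊥) (hy : y ∈ effDom φ) :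
    objective f φ y = ((f y + (φ y).toReal : ℝ) : EReal) := by
  rw [objective, ← coe_toReal_of_mem_effDom hbot hy, EReal.toReal_coe, EReal.coe_add]

theorem mem_effDom_objective_iff : y ∈ effDom (objective f φ) ↔ y ∈ effDom φ := by
  simp only [effDom, objective, Set.mem_ofPred_eq]
  constructor
  · intro h
    by_contra h1
    rw [not_lt_top_iff] at h1
    rw [h1, EReal.coe_add_top] at h
    exact lt_irrefl _ h
  · intro h
    exact EReal.add_lt_top (EReal.coe_ne_top _) (ne_of_lt h)

theorem quadModel_add_smul_one :
    quadModel f φ (B + μ • (1 : Matrix (Fin n) (Fin n) ℝ)) x y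
      = ((f x + regQuadratic (gradient f x) (Matrix.toEuclideanCLM (𝕜 := ℝ) B) μ (y - x) : ℝ)
        : EReal) + φ y := by
  unfold quadModel regQuadratic
  congr 2
  rw [map_add, map_smul, map_one]
  simp only [add_apply, smul_apply, one_apply_eq_self, inner_add_right, inner_smul_right, real_inner_self_eq_norm_sq]
  ring

theorem quadModel_eq :
    quadModel f φ B x y
      = ((f x + regQuadratic (gradient f x) (Matrix.toEuclideanCLM (𝕜 := ℝ) B) 0 (y - x) : ℝ)
        : EReal) + φ y := by
  unfold quadModel regQuadratic
  congr 2
  ring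

theorem IsSubproblemSolution.mem_effDom (h : IsSubproblemSolution f φ B μ x y)
    (hx : x ∈ effDom φ) : y ∈ effDom φ := by
  have h1 := h x
  rw [quadModel_add_smul_one, quadModel_add_smul_one] at h1
  by_contra h2
  have h3 : φ y = ⊤ := not_lt_top_iff.1 h2
  rw [h3, EReal.coe_add_top, top_le_iff] at h1
  exact (EReal.add_lt_top (EReal.coe_ne_top _) (ne_of_lt hx)).ne h1

theorem IsSubproblemSolution.le (hφ : ∀ x, φ x ≠ ⊥) (h : IsSubproblemSolution f φ B μ x y)
    (hx : x ∈ effDom φ) (hz : z ∈ effDom φ) :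
    regQuadratic (gradient f x) (Matrix.toEuclideanCLM (𝕜 := ℝ) B) μ (y - x) + (φ y).toReal
      ≤ regQuadratic (gradient f x) (Matrix.toEuclideanCLM (𝕜 := ℝ) B) μ (z - x)
        + (φ z).toReal := by
  have h1 := h z
  rw [quadModel_add_smul_one, quadModel_add_smul_one,
    ← coe_toReal_of_mem_effDom (hφ y) (h.mem_effDom hx), ← coe_toReal_of_mem_effDom (hφ z) hz,
    ← EReal.coe_add, ← EReal.coe_add, EReal.coe_le_coe_iff] at h1
  linarith

/-- The predicted decrease dominates the proximal term. -/
theorem IsSubproblemSolution.le_pred (hφ : ∀ x, φ x ≠ ⊥) (h : IsSubproblemSolution f φ B μ x y)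
    (hx : x ∈ effDom φ) :
    μ / 2 * ‖y - x‖ ^ 2 ≤ (φ x).toReal
      - regQuadratic (gradient f x) (Matrix.toEuclideanCLM (𝕜 := ℝ) B) 0 (y - x)
      - (φ y).toReal := by
  have h1 := h.le hφ hx hx
  rw [sub_self, regQuadratic_apply_zero, regQuadratic_eq_add] at h1
  linarith

theorem sufficientDecrease_iff (hφ : ∀ x, φ x ≠ ⊥) {c₁ : ℝ} (hx : x ∈ effDom φ)
    (hy : y ∈ effDom φ) :
    (c₁ : EReal) * (objective f φ x - quadModel f φ B x y) ≤ objective f φ x - objective f φ y ↔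
      c₁ * ((φ x).toReal
        - regQuadratic (gradient f x) (Matrix.toEuclideanCLM (𝕜 := ℝ) B) 0 (y - x)
        - (φ y).toReal) ≤ f x + (φ x).toReal - (f y + (φ y).toReal) := by
  rw [objective_eq_coe (hφ x) hx, objective_eq_coe (hφ y) hy, quadModel_eq,
    ← coe_toReal_of_mem_effDom (hφ y) hy]
  simp only [EReal.toReal_coe]
  rw [← EReal.coe_add, ← EReal.coe_sub, ← EReal.coe_sub, ← EReal.coe_mul, EReal.coe_le_coe_iff]
  ring_nf

/-- The descent of the objective along an accepted step. -/
theorem IsAccepted.descent (hφ : ∀ x, φ x ≠ ⊥) {c₁ : ℝ} (hc₁ : 0 < c₁)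
    (h : IsAccepted f φ c₁ B μ x y) (hx : x ∈ effDom φ) :
    c₁ * μ / 2 * ‖y - x‖ ^ 2 ≤ f x + (φ x).toReal - (f y + (φ y).toReal) := by
  have h1 := (sufficientDecrease_iff hφ hx (h.1.mem_effDom hx)).1 h.2
  have h2 := mul_le_mul_of_nonneg_left (h.1.le_pred hφ hx) hc₁.le
  linarith

/-! ### Subgradients at subproblem solutions -/

theorem regularSubdiff_subset_limitingSubdiff (g : EuclideanSpace ℝ (Fin n) → EReal)
    (x : EuclideanSpace ℝ (Fin n)) : regularSubdiff g x ⊆ limitingSubdiff g x := fun v hv =>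
  ⟨hv.1, fun _ => x, fun _ => v, tendsto_const_nhds, tendsto_const_nhds, fun _ => hv,
    tendsto_const_nhds⟩

/-- Compare the model at `y` and at a nearby `z`, expand the quadratic exactly about `y - x`, and
replace `f` by its first-order expansion at `y`. Half of `ε` absorbs the remainder of `f`, the other
half the quadratic term in `z - y`. -/
theorem IsSubproblemSolution.mem_regularSubdiff (hφ : ∀ x, φ x ≠ ⊥)
    (h : IsSubproblemSolution f φ B μ x y) (hx : x ∈ effDom φ) (hf : DifferentiableAt ℝ f y) :
    gradient f y - regQuadraticGradient (gradient f x) (Matrix.toEuclideanCLM (𝕜 := ℝ) B) μ (y - x)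
      ∈ regularSubdiff (objective f φ) y := by
  have hy := h.mem_effDom hx
  refine ⟨mem_effDom_objective_iff.2 hy, fun ε hε => ?_⟩
  set T := Matrix.toEuclideanCLM (𝕜 := ℝ) B with hT
  have h1 := (hasGradientAt_iff_isLittleO.1 hf.hasGradientAt).def (half_pos hε)
  have h2 : ∀ᶠ z in 𝓝 y, (|μ| + ‖T‖) / 2 * ‖z - y‖ < ε / 2 := by
    have : Tendsto (fun z => (|μ| + ‖T‖) / 2 * ‖z - y‖) (𝓝 y) (𝓝 ((|μ| + ‖T‖) / 2 * ‖y - y‖)) :=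
      Continuous.tendsto (by fun_prop) y
    exact this.eventually_lt_const (by simpa using half_pos hε)
  filter_upwards [h1, h2] with z hz1 hz2
  by_cases hz : z ∈ effDom φ
  · rw [objective_eq_coe (hφ y) hy, objective_eq_coe (hφ z) hz, ← EReal.coe_add,
      EReal.coe_le_coe_iff]
    have h3 := h.le hφ hx hz
    have h4 : z - x = (y - x) + (z - y) := by abel
    rw [h4, regQuadratic_add] at h3
    have h5 := regQuadratic_le (g := 0) (G := 0) (by simp) (le_refl ‖T‖) μ (z - y)
    rw [Real.norm_eq_abs] at hz1
    have h6 := (abs_le.1 hz1).1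
    have h7 := mul_le_mul_of_nonneg_right hz2.le (norm_nonneg (z - y))
    have h8 := mul_le_mul_of_nonneg_right (le_abs_self μ) (sq_nonneg ‖z - y‖)
    rw [inner_sub_left]
    nlinarith
  · have h3 : φ z = ⊤ := not_lt_top_iff.1 hz
    have h4 : objective f φ z = ⊤ := by rw [objective, h3, EReal.coe_add_top]
    rw [h4]
    exact le_top

/-- In the subgradient just found, `∇f x` occurs only through `∇f y - ∇f x`; every other term is
linear in `y - x`. -/
theorem IsSubproblemSolution.infEDist_le (hφ : ∀ x, φ x ≠ ⊥)
    (h : IsSubproblemSolution f φ B μ x y) (hx : x ∈ effDom φ) (hf : DifferentiableAt ℝ f y)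
    {L M : ℝ} (hL : ‖gradient f y - gradient f x‖ ≤ L * ‖y - x‖)
    (hM : ‖Matrix.toEuclideanCLM (𝕜 := ℝ) B‖ ≤ M) (hμ : 0 ≤ μ) :
    Metric.infEDist 0 (limitingSubdiff (objective f φ) y)
      ≤ ENNReal.ofReal ((L + M + μ) * ‖y - x‖) := by
  refine (Metric.infEDist_le_edist_of_mem
    (regularSubdiff_subset_limitingSubdiff _ _ (h.mem_regularSubdiff hφ hx hf))).trans ?_
  rw [edist_dist, dist_zero_left]
  apply ENNReal.ofReal_le_ofReal
  set T := Matrix.toEuclideanCLM (𝕜 := ℝ) B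
  set d := y - x
  have h1 : gradient f y - regQuadraticGradient (gradient f x) T μ d
      = (gradient f y - gradient f x) - (1 / 2 : ℝ) • (T d + ContinuousLinearMap.adjoint T d)
        - μ • d := by
    unfold regQuadraticGradient; abel
  have h2 := T.le_of_opNorm_le hM d
  have h3 : ‖ContinuousLinearMap.adjoint T d‖ ≤ M * ‖d‖ :=
    ContinuousLinearMap.le_of_opNorm_le _ (by rwa [LinearIsometryEquiv.norm_map]) d
  rw [h1]
  calc _ ≤ ‖gradient f y - gradient f x‖
        + ‖(1 / 2 : ℝ) • (T d + ContinuousLinearMap.adjoint T d)‖ + ‖μ • d‖ :=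
        (norm_sub_le _ _).trans (by gcongr; exact norm_sub_le _ _)
    _ ≤ L * ‖d‖ + 1 / 2 * (M * ‖d‖ + M * ‖d‖) + μ * ‖d‖ := by
        rw [norm_smul, norm_smul, Real.norm_of_nonneg hμ, Real.norm_of_nonneg (by norm_num)]
        gcongr
        exact (norm_add_le _ _).trans (add_le_add h2 h3)
    _ = _ := by ring

/-! ### Local success of the method -/

theorem ProxBounded.exists_quadratic_le (h : ProxBounded φ) :
    ∃ (β m : ℝ) (x₀ : EuclideanSpace ℝ (Fin n)), 0 < β ∧
      ∀ z, z ∈ effDom φ → φ z ≠ ⊥ → m - β * ‖z - x₀‖ ^ 2 ≤ (φ z).toReal := by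
  obtain ⟨γ, hγ, x₀, hx₀⟩ := h
  obtain ⟨m, -, hm⟩ := EReal.lt_iff_exists_real_btwn.1 hx₀
  refine ⟨1 / (2 * γ), m, x₀, by positivity, fun z hz hz' => ?_⟩
  have h1 := hm.le.trans (iInf_le _ z)
  rw [← coe_toReal_of_mem_effDom hz' hz, ← EReal.coe_add, EReal.coe_le_coe_iff] at h1
  linarith

/-- Bounds for `f` and its gradient on a closed ball of radius `2ρ`. -/
structure LocalSmoothBounds {E : Type*} [NormedAddCommGroup E] [InnerProductSpace ℝ E]
    [CompleteSpace E] (f : E → ℝ) (xs : E) (ρ L G V : ℝ) : Prop where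
  ρ_pos : 0 < ρ
  L_pos : 0 < L
  differentiableAt : ∀ p ∈ Metric.closedBall xs (2 * ρ), DifferentiableAt ℝ f p
  gradient_le : ∀ p ∈ Metric.closedBall xs (2 * ρ), ‖gradient f p‖ ≤ G
  abs_le : ∀ p ∈ Metric.closedBall xs (2 * ρ), |f p| ≤ V
  lipschitz : ∀ p ∈ Metric.closedBall xs (2 * ρ), ∀ q ∈ Metric.closedBall xs (2 * ρ),
    ‖gradient f p - gradient f q‖ ≤ L * ‖p - q‖

theorem exists_localSmoothBounds (h : BlanketAssumption f φ) (hLip : LocLipschitzGradient f φ)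
    (hx : x ∈ effDom φ) : ∃ ρ L G V, LocalSmoothBounds f x ρ L G V := by
  obtain ⟨O, hO, hsub, hC⟩ := h.smooth
  obtain ⟨L, hL, ε, hε, hl⟩ := hLip x hx
  obtain ⟨δ, hδ, hδO⟩ := Metric.nhds_basis_closedBall.mem_iff.1 (hO.mem_nhds (hsub hx))
  -- Halving leaves room for a point within `ρ` of the centre and a trial point within `ρ` of that
  -- point.
  set ρ := min δ ε / 2 with hρdef
  have hρ : 0 < ρ := by positivity
  have h2ρ : 2 * ρ = min δ ε := by rw [hρdef]; ring
  have hρO : Metric.closedBall x (2 * ρ) ⊆ O :=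
    (Metric.closedBall_subset_closedBall (by rw [h2ρ]; exact min_le_left _ _)).trans hδO
  have hρε : Metric.closedBall x (2 * ρ) ⊆ Metric.closedBall x ε :=
    Metric.closedBall_subset_closedBall (by rw [h2ρ]; exact min_le_right _ _)
  obtain ⟨V, hV⟩ := (isCompact_closedBall x (2 * ρ)).exists_bound_of_continuousOn
    (hC.continuousOn.mono hρO)
  refine ⟨ρ, L, ‖gradient f x‖ + L * (2 * ρ), V, hρ, hL, fun p hp => ?_, fun p hp => ?_,
    fun p hp => hV p hp, fun p hp q hq => hl p (hρε hp) q (hρε hq)⟩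
  · exact (hC.differentiableOn one_ne_zero).differentiableAt (hO.mem_nhds (hρO hp))
  · have h1 := hl p (hρε hp) x (Metric.mem_closedBall_self hε.le)
    have h2 : ‖p - x‖ ≤ 2 * ρ := by rwa [← dist_eq_norm]
    have h3 := mul_le_mul_of_nonneg_left h2 hL.le
    have h4 := norm_le_norm_add_norm_sub' (gradient f p) (gradient f x)
    linarith

/-- Mean value inequality on the segment, for `f` minus its linearization at `p`. The constant `L`
instead of `L / 2` is enough here. -/
theorem LocalSmoothBounds.descent_lemma {E : Type*} [NormedAddCommGroup E] [InnerProductSpace ℝ E]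
    [CompleteSpace E] {f : E → ℝ} {xs : E} {ρ L G V : ℝ} (h : LocalSmoothBounds f xs ρ L G V)
    {p q : E} (hp : p ∈ Metric.closedBall xs (2 * ρ)) (hq : q ∈ Metric.closedBall xs (2 * ρ)) :
    f q ≤ f p + inner ℝ (gradient f p) (q - p) + L * ‖q - p‖ ^ 2 := by
  have hseg : segment ℝ p q ⊆ Metric.closedBall xs (2 * ρ) :=
    (convex_closedBall _ _).segment_subset hp hq
  have h1 := (convex_segment p q).norm_image_sub_le_of_norm_hasFDerivWithin_le' (𝕜 := ℝ)
    (f := f) (f' := fun z => fderiv ℝ f z) (φ := fderiv ℝ f p) (C := L * ‖q - p‖)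
    (fun z hz => (h.differentiableAt z (hseg hz)).hasFDerivAt.hasFDerivWithinAt)
    (fun z hz => by
      rw [← toDual_gradient, ← toDual_gradient, ← map_sub, LinearIsometryEquiv.norm_map]
      refine (h.lipschitz z (hseg hz) p hp).trans ?_
      have := norm_sub_le_of_mem_segment hz
      exact mul_le_mul_of_nonneg_left this h.L_pos.le)
    (left_mem_segment ℝ p q) (right_mem_segment ℝ p q)
  have h2 : fderiv ℝ f p (q - p) = inner ℝ (gradient f p) (q - p) := by
    rw [← toDual_gradient, InnerProductSpace.toDual_apply_apply]
  rw [h2, Real.norm_eq_abs] at h1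
  have h3 := (_root_.abs_le.1 h1).2
  linarith

/-- For a large regularization parameter, the model exceeds the current value away from the current
point, uniformly near `xs`. -/
theorem exists_threshold_model_gt (h : BlanketAssumption f φ) {xs : EuclideanSpace ℝ (Fin n)}
    {ρ L G V : ℝ} (hloc : LocalSmoothBounds f xs ρ L G V) (M F₀ : ℝ) :
    ∃ μ₀ : ℝ, ∀ (p : EuclideanSpace ℝ (Fin n)) (B : Matrix (Fin n) (Fin n) ℝ) (μ : ℝ),
      ‖p - xs‖ ≤ ρ → f p + (φ p).toReal ≤ F₀ →
      ‖Matrix.toEuclideanCLM (𝕜 := ℝ) B‖ ≤ M → μ₀ ≤ μ →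
      ∀ z ∈ effDom φ, ρ ≤ ‖z - p‖ →
        (φ p).toReal < regQuadratic (gradient f p) (Matrix.toEuclideanCLM (𝕜 := ℝ) B) μ (z - p)
          + (φ z).toReal := by
  obtain ⟨β, m, x₀, hβ, hm⟩ := h.proxBounded.exists_quadratic_le
  have hρ := hloc.ρ_pos
  set D := ‖xs - x₀‖ + ρ with hD
  have hD0 : 0 ≤ D := by positivity
  set A := |F₀| + V + |m| with hA
  have hxs : xs ∈ Metric.closedBall xs (2 * ρ) := Metric.mem_closedBall_self (by positivity)
  have hV0 : 0 ≤ V := (abs_nonneg _).trans (hloc.abs_le xs hxs)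
  have hG0 : 0 ≤ G := (norm_nonneg _).trans (hloc.gradient_le xs hxs)
  have hA0 : 0 ≤ A := by positivity
  -- As `t = ‖z - p‖ ≥ ρ`, the linear term, the prox-bound and the constants are each at most a
  -- multiple of `t²`. The three summands are these multiples; the final `1` makes the inequality
  -- strict.
  refine ⟨M + 2 * (G / ρ + β * (1 + D / ρ) ^ 2 + A / ρ ^ 2) + 1,
    fun p B μ hp hF hB hμ z hz hzp => ?_⟩
  have hpb : p ∈ Metric.closedBall xs (2 * ρ) := by
    rw [Metric.mem_closedBall, dist_eq_norm]; linarith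
  have h1 := le_regQuadratic (hloc.gradient_le p hpb) hB μ (z - p)
  have h2 := hm z hz (h.proper.1 z)
  have h3 := abs_le.1 (hloc.abs_le p hpb)
  have h4 : ‖z - x₀‖ ≤ ‖z - p‖ + D := by
    have e1 := norm_sub_le_norm_sub_add_norm_sub z p x₀
    have e2 := norm_sub_le_norm_sub_add_norm_sub p xs x₀
    linarith
  set t := ‖z - p‖ with ht
  have ht0 : 0 < t := lt_of_lt_of_le hρ hzp
  have h5 : 1 ≤ t / ρ := by rwa [le_div_iff₀ hρ, one_mul]
  have h6 : D ≤ D / ρ * t := by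
    have := mul_le_mul_of_nonneg_left h5 hD0
    calc D = D * 1 := by ring
      _ ≤ D * (t / ρ) := this
      _ = D / ρ * t := by ring
  have h7 : ‖z - x₀‖ ^ 2 ≤ (1 + D / ρ) ^ 2 * t ^ 2 := by
    rw [← mul_pow]
    exact pow_le_pow_left₀ (norm_nonneg _) (by linarith) 2
  have h8 : G * t ≤ G / ρ * t ^ 2 := by
    have := mul_le_mul_of_nonneg_left h5 (by positivity : 0 ≤ G * t)
    calc G * t = G * t * 1 := by ring
      _ ≤ G * t * (t / ρ) := this
      _ = _ := by ring
  have h9 : A ≤ A / ρ ^ 2 * t ^ 2 := by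
    have : 1 ≤ (t / ρ) ^ 2 := one_le_pow₀ h5
    have := mul_le_mul_of_nonneg_left this hA0
    calc A = A * 1 := by ring
      _ ≤ A * (t / ρ) ^ 2 := this
      _ = _ := by ring
  have h10 := mul_le_mul_of_nonneg_left h7 hβ.le
  have h11 := mul_le_mul_of_nonneg_right hμ (sq_nonneg t)
  have h12 : 0 < t ^ 2 := by positivity
  have h13 := neg_abs_le m
  have h14 := le_abs_self F₀
  linarith

/-- A lower semicontinuous model attains its minimum on the compact `ρ`-ball, and outside the ball
it is no smaller than at the centre. -/
theorem exists_isSubproblemSolution (h : BlanketAssumption f φ) {ρ : ℝ} (hρ : 0 ≤ ρ)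
    (hx : x ∈ effDom φ)
    (hgt : ∀ z ∈ effDom φ, ρ ≤ ‖z - x‖ →
        (φ x).toReal < regQuadratic (gradient f x) (Matrix.toEuclideanCLM (𝕜 := ℝ) B) μ (z - x)
          + (φ z).toReal) :
    ∃ y, IsSubproblemSolution f φ B μ x y := by
  have hφ := h.proper.1
  have hlsc : LowerSemicontinuous
      (fun z => quadModel f φ (B + μ • (1 : Matrix (Fin n) (Fin n) ℝ)) x z) := by
    simp only [quadModel_add_smul_one]
    refine LowerSemicontinuous.add' (Continuous.lowerSemicontinuous ?_) h.lsc fun z => ?_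
    · exact continuous_coe_real_ereal.comp (continuous_const.add
        ((continuous_regQuadratic _ _ _).comp (continuous_id.sub continuous_const)))
    · exact EReal.continuousAt_add (Or.inl (EReal.coe_ne_top _)) (Or.inl (EReal.coe_ne_bot _))
  have hxb : x ∈ Metric.closedBall x ρ := Metric.mem_closedBall_self hρ
  obtain ⟨y, -, hy⟩ := LowerSemicontinuousOn.exists_isMinOn ⟨x, hxb⟩ (isCompact_closedBall x ρ)
    (hlsc.lowerSemicontinuousOn _)
  refine ⟨y, fun z => ?_⟩
  by_cases hz : z ∈ Metric.closedBall x ρ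
  · exact hy hz
  refine (hy hxb).trans ?_
  simp only [quadModel_add_smul_one]
  by_cases hz' : z ∈ effDom φ
  · rw [Metric.mem_closedBall, dist_eq_norm, not_le] at hz
    have h1 := hgt z hz' hz.le
    rw [← coe_toReal_of_mem_effDom (hφ x) hx, ← coe_toReal_of_mem_effDom (hφ z) hz',
      ← EReal.coe_add, ← EReal.coe_add, EReal.coe_le_coe_iff]
    rw [sub_self, regQuadratic_apply_zero]
    linarith
  · have h3 : φ z = ⊤ := not_lt_top_iff.1 hz'
    rw [h3, EReal.coe_add_top]
    exact le_top

/-- Near a point of the domain, every iteration with a sufficiently large regularization parameter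
is successful. -/
theorem exists_threshold_accepted (h : BlanketAssumption f φ) {xs : EuclideanSpace ℝ (Fin n)}
    {ρ L G V : ℝ} (hloc : LocalSmoothBounds f xs ρ L G V) {c₁ : ℝ} (hc₁ : c₁ ∈ Set.Ioo (0 : ℝ) 1)
    (M F₀ : ℝ) :
    ∃ μ₀ : ℝ, ∀ (p : EuclideanSpace ℝ (Fin n)) (B : Matrix (Fin n) (Fin n) ℝ) (μ : ℝ),
      p ∈ effDom φ → ‖p - xs‖ ≤ ρ → f p + (φ p).toReal ≤ F₀ →
      ‖Matrix.toEuclideanCLM (𝕜 := ℝ) B‖ ≤ M → μ₀ ≤ μ →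
      (∃ y, IsSubproblemSolution f φ B μ p y) ∧
        ∀ y, IsSubproblemSolution f φ B μ p y → IsAccepted f φ c₁ B μ p y := by
  obtain ⟨μ₀, hμ₀⟩ := exists_threshold_model_gt h hloc M F₀
  have hφ := h.proper.1
  have hc : 0 < 1 - c₁ := by linarith [hc₁.2]
  -- The first threshold keeps the trial point within `ρ`. There `f` exceeds its quadratic model by
  -- at most `(L + M/2) ‖y - p‖²`, which `(1 - c₁) pred ≥ (1 - c₁) μ/2 ‖y - p‖²` covers under the
  -- second.
  refine ⟨max μ₀ ((2 * L + M) / (1 - c₁)), fun p B μ hp hpρ hF hB hμ => ?_⟩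
  have hgt := hμ₀ p B μ hpρ hF hB ((le_max_left _ _).trans hμ)
  refine ⟨exists_isSubproblemSolution h hloc.ρ_pos.le hp hgt, fun y hy => ⟨hy, ?_⟩⟩
  have hyd := hy.mem_effDom hp
  have h1 : ‖y - p‖ < ρ := by
    by_contra! hcon
    have h2 := hgt y hyd hcon
    have h3 := hy.le hφ hp hp
    rw [sub_self, regQuadratic_apply_zero] at h3
    linarith
  have hpb : p ∈ Metric.closedBall xs (2 * ρ) := by
    rw [Metric.mem_closedBall, dist_eq_norm]; linarith [hloc.ρ_pos]
  have hyb : y ∈ Metric.closedBall xs (2 * ρ) := by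
    rw [Metric.mem_closedBall, dist_eq_norm]
    have := norm_sub_le_norm_sub_add_norm_sub y p xs
    linarith
  have h2 := hloc.descent_lemma hpb hyb
  rw [sufficientDecrease_iff hφ hp hyd]
  have h3 := hy.le_pred hφ hp
  set T := Matrix.toEuclideanCLM (𝕜 := ℝ) B
  have h4 := (abs_le.1 (abs_inner_apply_le hB (y - p))).1
  have h5 : (2 * L + M) ≤ μ * (1 - c₁) :=
    (div_le_iff₀ hc).1 ((le_max_right _ _).trans hμ)
  have h6 := mul_le_mul_of_nonneg_right h5 (sq_nonneg ‖y - p‖)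
  have h7 := mul_le_mul_of_nonneg_left h3 hc.le
  have h8 : regQuadratic (gradient f p) T 0 (y - p)
      = inner ℝ (gradient f p) (y - p) + 1 / 2 * inner ℝ (y - p) (T (y - p)) := by
    simp [regQuadratic]
  rw [h8] at h7 ⊢
  linarith

end Model

/-! ### Runs of the method -/

namespace IsRPQNRun

variable {n : ℕ} {f : EuclideanSpace ℝ (Fin n) → ℝ} {φ : EuclideanSpace ℝ (Fin n) → EReal}
  {c₁ σ₂ μmin μmax : ℝ} {x xhat : ℕ → EuclideanSpace ℝ (Fin n)}
  {B : ℕ → Matrix (Fin n) (Fin n) ℝ} {μ : ℕ → ℝ}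

theorem mem_effDom (h : IsRPQNRun f φ c₁ σ₂ μmin μmax x xhat B μ) (k : ℕ) : x k ∈ effDom φ := by
  induction k with
  | zero => exact h.x_zero
  | succ k ih =>
    by_cases hk : IsAccepted f φ c₁ (B k) (μ k) (x k) (xhat k)
    · rw [(h.successful k hk).1]
      exact hk.1.mem_effDom ih
    · rwa [(h.unsuccessful k hk).1]

theorem μmin_le (h : IsRPQNRun f φ c₁ σ₂ μmin μmax x xhat B μ) (k : ℕ) : μmin ≤ μ k := by
  induction k with
  | zero => exact h.μ_zero.1
  | succ k ih =>
    by_cases hk : IsAccepted f φ c₁ (B k) (μ k) (x k) (xhat k)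
    · exact (h.successful k hk).2.1
    · rw [(h.unsuccessful k hk).2.2]
      nlinarith [h.one_lt_σ₂, h.μmin_pos]

theorem descent (h : IsRPQNRun f φ c₁ σ₂ μmin μmax x xhat B μ) (hφ : ∀ x, φ x ≠ ⊥) (k : ℕ) :
    c₁ * μmin / 2 * ‖x (k + 1) - x k‖ ^ 2
      ≤ f (x k) + (φ (x k)).toReal - (f (x (k + 1)) + (φ (x (k + 1))).toReal) := by
  by_cases hk : IsAccepted f φ c₁ (B k) (μ k) (x k) (xhat k)
  · rw [(h.successful k hk).1]
    refine le_trans ?_ (hk.descent hφ h.c₁_mem.1 (h.mem_effDom k))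
    have h0 := h.c₁_mem.1
    have h1 := h.μmin_le k
    gcongr
  · rw [(h.unsuccessful k hk).1]
    simp

theorem antitone (h : IsRPQNRun f φ c₁ σ₂ μmin μmax x xhat B μ) (hφ : ∀ x, φ x ≠ ⊥) :
    Antitone fun k => f (x k) + (φ (x k)).toReal :=
  antitone_nat_of_succ_le fun k => by
    have h1 := h.descent hφ k
    have h2 : 0 ≤ c₁ * μmin / 2 * ‖x (k + 1) - x k‖ ^ 2 := by
      have := h.c₁_mem.1
      have := h.μmin_pos
      positivity
    linarith

theorem exists_tendsto (h : IsRPQNRun f φ c₁ σ₂ μmin μmax x xhat B μ)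
    (hb : BlanketAssumption f φ) :
    ∃ l, Tendsto (fun k => f (x k) + (φ (x k)).toReal) atTop (𝓝 l) := by
  obtain ⟨m, -, hm⟩ := EReal.lt_iff_exists_real_btwn.1 hb.bddBelow
  refine ⟨_, tendsto_atTop_ciInf (h.antitone hb.proper.1) ⟨m, ?_⟩⟩
  rintro _ ⟨k, rfl⟩
  have h1 := hm.le.trans (iInf_le _ (x k))
  rwa [objective_eq_coe (hb.proper.1 _) (h.mem_effDom k), EReal.coe_le_coe_iff] at h1

theorem tendsto_step (h : IsRPQNRun f φ c₁ σ₂ μmin μmax x xhat B μ)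
    (hb : BlanketAssumption f φ) :
    Tendsto (fun k => ‖x (k + 1) - x k‖) atTop (𝓝 0) := by
  obtain ⟨l, hl⟩ := h.exists_tendsto hb
  have hpos : 0 < c₁ * μmin / 2 := by
    have := h.c₁_mem.1
    have := h.μmin_pos
    positivity
  have h1 : Tendsto (fun k => ‖x (k + 1) - x k‖ ^ 2) atTop (𝓝 0) := by
    refine squeeze_zero (fun _ => sq_nonneg _) (fun k => (le_div_iff₀' hpos).2
      (h.descent hb.proper.1 k)) ?_
    have := (hl.sub ((tendsto_add_atTop_iff_nat 1).2 hl)).div_const (c₁ * μmin / 2)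
    simpa using this
  simpa [Real.sqrt_sq (norm_nonneg _)] using h1.sqrt

variable {xs : EuclideanSpace ℝ (Fin n)} {ρ μ₀ : ℝ}

/-- Iterations in the `ρ`-ball around `xs` with regularization parameter at least `μ₀` are
successful. -/
theorem exists_threshold (h : IsRPQNRun f φ c₁ σ₂ μmin μmax x xhat B μ)
    (hb : BlanketAssumption f φ) {L G V M : ℝ} (hloc : LocalSmoothBounds f xs ρ L G V)
    (hB : ∀ k, ‖Matrix.toEuclideanCLM (𝕜 := ℝ) (B k)‖ ≤ M) :
    ∃ μ₀, ∀ k, ‖x k - xs‖ ≤ ρ → μ₀ ≤ μ k →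
      k ∈ successfulIterations f φ c₁ x xhat B μ := by
  obtain ⟨μ₀, hμ₀⟩ := exists_threshold_accepted hb hloc h.c₁_mem M
    (f (x 0) + (φ (x 0)).toReal)
  refine ⟨μ₀, fun k hk hμ => ?_⟩
  obtain ⟨h1, h2⟩ := hμ₀ (x k) (B k) (μ k) (h.mem_effDom k) hk
    (h.antitone hb.proper.1 (Nat.zero_le k)) (hB k) hμ
  exact h2 _ (h.found k h1)

/-- An increase of `μ` comes from a failed iteration at the same point. Near `xs` such a failure
requires the previous parameter to be below `μ₀`. -/
theorem μ_le (h : IsRPQNRun f φ c₁ σ₂ μmin μmax x xhat B μ)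
    (hμ₀ : ∀ k, ‖x k - xs‖ ≤ ρ → μ₀ ≤ μ k → k ∈ successfulIterations f φ c₁ x xhat B μ)
    (k : ℕ) (hk : ‖x k - xs‖ ≤ ρ) : μ k ≤ max μmax (σ₂ * μ₀) := by
  cases k with
  | zero => exact h.μ_zero.2.trans (le_max_left _ _)
  | succ k =>
    by_cases hs : IsAccepted f φ c₁ (B k) (μ k) (x k) (xhat k)
    · exact (h.successful k hs).2.2.trans (le_max_left _ _)
    · obtain ⟨h1, -, h3⟩ := h.unsuccessful k hs
      rw [h1] at hk
      have h4 : μ k < μ₀ := by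
        by_contra! hcon
        exact hs (hμ₀ k hk hcon)
      rw [h3]
      exact (mul_le_mul_of_nonneg_left h4.le (by linarith [h.one_lt_σ₂])).trans (le_max_right _ _)

theorem eq_of_unsuccessful (h : IsRPQNRun f φ c₁ σ₂ μmin μmax x xhat B μ) {k i : ℕ}
    (hi : ∀ j < i, k + j ∉ successfulIterations f φ c₁ x xhat B μ) :
    x (k + i) = x k ∧ μ (k + i) = σ₂ ^ i * μ k := by
  induction i with
  | zero => simp
  | succ i ih =>
    obtain ⟨h1, h2⟩ := ih fun j hj => hi j (by omega)
    obtain ⟨h3, -, h4⟩ := h.unsuccessful (k + i) (hi i (by omega))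
    exact ⟨by rw [← add_assoc, h3, h1], by rw [← add_assoc, h4, h2]; ring⟩

/-- Near `xs` the number of consecutive unsuccessful iterations is bounded. -/
theorem exists_gap_bound (h : IsRPQNRun f φ c₁ σ₂ μmin μmax x xhat B μ)
    (hμ₀ : ∀ k, ‖x k - xs‖ ≤ ρ → μ₀ ≤ μ k → k ∈ successfulIterations f φ c₁ x xhat B μ) :
    ∃ N, ∀ k, ‖x k - xs‖ ≤ ρ → ∃ i ≤ N, k + i ∈ successfulIterations f φ c₁ x xhat B μ := by
  obtain ⟨N, hN⟩ := pow_unbounded_of_one_lt (μ₀ / μmin) h.one_lt_σ₂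
  rw [div_lt_iff₀ h.μmin_pos] at hN
  refine ⟨N, fun k hk => ?_⟩
  by_contra! hcon
  obtain ⟨h1, h2⟩ := h.eq_of_unsuccessful fun j (hj : j < N) => hcon j hj.le
  refine hcon N le_rfl (hμ₀ _ (by rwa [h1]) ?_)
  rw [h2]
  have h3 : 0 ≤ σ₂ ^ N := pow_nonneg (by linarith [h.one_lt_σ₂]) N
  exact hN.le.trans (mul_le_mul_of_nonneg_left (h.μmin_le k) h3)

/-- The objective values converge to the value at the accumulation point. -/
theorem tendsto_value (h : IsRPQNRun f φ c₁ σ₂ μmin μmax x xhat B μ)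
    (hb : BlanketAssumption f φ) {L G V M μhat : ℝ} (hloc : LocalSmoothBounds f xs ρ L G V)
    (hB : ∀ k, ‖Matrix.toEuclideanCLM (𝕜 := ℝ) (B k)‖ ≤ M)
    (hμ : ∀ k, ‖x k - xs‖ ≤ ρ → μ k ≤ μhat) (hxs : xs ∈ effDom φ)
    (hacc : MapClusterPt xs (atTop ⊓ 𝓟 (successfulIterations f φ c₁ x xhat B μ)) x) :
    Tendsto (fun k => f (x k) + (φ (x k)).toReal) atTop (𝓝 (f xs + (φ xs).toReal)) := by
  obtain ⟨l, hl⟩ := h.exists_tendsto hb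
  have hφ := hb.proper.1
  -- An ultrafilter on the successful indices turns the cluster point into a limit without choosing
  -- a subsequence.
  obtain ⟨F, hF, hFx⟩ := mapClusterPt_iff_ultrafilter.1 hacc
  have hFtop : (F : Filter ℕ) ≤ atTop := hF.trans inf_le_left
  have hFS : ∀ᶠ k in F, k ∈ successfulIterations f φ c₁ x xhat B μ :=
    hF.trans inf_le_right (mem_principal_self _)
  have hlF := hl.mono_left hFtop
  have hlF1 := ((tendsto_add_atTop_iff_nat 1).2 hl).mono_left hFtop
  have hdF := (h.tendsto_step hb).mono_left hFtop
  have hρ := hloc.ρ_pos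
  have hfc : ContinuousAt f xs :=
    (hloc.differentiableAt xs (Metric.mem_closedBall_self (by positivity))).continuousAt
  have hnear : ∀ᶠ k in F, ‖x k - xs‖ ≤ ρ := by
    have := hFx (Metric.closedBall_mem_nhds xs hρ)
    filter_upwards [this] with k hk
    rwa [← dist_eq_norm]
  have hlower : f xs + (φ xs).toReal ≤ l := by
    refine le_of_forall_pos_le_add fun ε hε => ?_
    have h1 : (((φ xs).toReal - ε : ℝ) : EReal) < φ xs := by
      conv_rhs => rw [← coe_toReal_of_mem_effDom (hφ xs) hxs]
      rw [EReal.coe_lt_coe_iff]; linarith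
    have h2 := hFx.eventually (hb.lsc xs _ h1)
    have h3 : ∀ᶠ k in F, f (x k) + ((φ xs).toReal - ε) ≤ f (x k) + (φ (x k)).toReal := by
      filter_upwards [h2] with k hk
      rw [← coe_toReal_of_mem_effDom (hφ _) (h.mem_effDom k), gt_iff_lt,
        EReal.coe_lt_coe_iff] at hk
      linarith
    have h4 := le_of_tendsto_of_tendsto
      ((hfc.tendsto.comp hFx).add_const ((φ xs).toReal - ε)) hlF h3
    linarith
  -- `x (k + 1)` minimizes the model, so `xs` is a competitor. All quadratic terms vanish in the
  -- limit because steps tend to `0` and `μ k ≤ μhat` near `xs`.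
  have hupper : l ≤ f xs + (φ xs).toReal := by
    have hx1 : Tendsto (fun k => x (k + 1)) F (𝓝 xs) := by
      have h1 : Tendsto (fun k => x (k + 1) - x k) F (𝓝 0) :=
        tendsto_zero_iff_norm_tendsto_zero.2 hdF
      simpa using h1.add hFx
    have he : Tendsto (fun k => ‖xs - x k‖) F (𝓝 0) := by
      have := (tendsto_const_nhds (x := xs)).sub hFx |>.norm
      simpa using this
    have hbound : ∀ᶠ k in F, f (x (k + 1)) + (φ (x (k + 1))).toReal ≤ f (x (k + 1))
        + (G * ‖x (k + 1) - x k‖ + M / 2 * ‖x (k + 1) - x k‖ ^ 2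
        + (G * ‖xs - x k‖ + (μhat + M) / 2 * ‖xs - x k‖ ^ 2)) + (φ xs).toReal := by
      filter_upwards [hFS, hnear] with k hk hkn
      have hsol := hk.1
      rw [← (h.successful k hk).1] at hsol
      have hkb : x k ∈ Metric.closedBall xs (2 * ρ) := by
        rw [Metric.mem_closedBall, dist_eq_norm]; linarith
      have h1 := hsol.le hφ (h.mem_effDom k) hxs
      have h2 := le_regQuadratic (hloc.gradient_le _ hkb) (hB k) (μ k) (x (k + 1) - x k)
      have h3 := regQuadratic_le (hloc.gradient_le _ hkb) (hB k) (μ k) (xs - x k)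
      have h4 := mul_le_mul_of_nonneg_right (hμ k hkn) (sq_nonneg ‖xs - x k‖)
      have h5 := mul_nonneg (h.μmin_pos.le.trans (h.μmin_le k)) (sq_nonneg ‖x (k + 1) - x k‖)
      linarith
    refine le_of_tendsto_of_tendsto hlF1 ?_ hbound
    have := ((hfc.tendsto.comp hx1).add
      (((hdF.const_mul G).add ((hdF.pow 2).const_mul (M / 2))).add
        ((he.const_mul G).add ((he.pow 2).const_mul ((μhat + M) / 2))))).add_const (φ xs).toReal
    simpa using this
  rwa [le_antisymm hupper hlower] at hl

end IsRPQNRun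

/-! ### The power-type KL inequality and the indexing of successes -/

theorem hasDerivAt_const_mul_rpow {c θ t : ℝ} (ht : 0 < t) :
    HasDerivAt (fun t : ℝ => c * t ^ (1 - θ)) (c * ((1 - θ) * t ^ (-θ))) t := by
  have := (Real.hasDerivAt_rpow_const (p := 1 - θ) (Or.inl ht.ne')).const_mul c
  rwa [show 1 - θ - 1 = -θ by ring] at this

/-- The Kurdyka–Łojasiewicz inequality for `χ t = c t ^ (1 - θ)`, combined with an upper bound for
the distance of `0` to the subdifferential. -/
theorem HasKLProperty.rpow_le {n : ℕ} {g : EuclideanSpace ℝ (Fin n) → EReal}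
    {xs y : EuclideanSpace ℝ (Fin n)} {c θ η : ℝ} {U : Set (EuclideanSpace ℝ (Fin n))}
    (h : HasKLProperty g xs (fun t => c * t ^ (1 - θ)) η U) (hc : 0 < c)
    (hθ : θ ∈ Set.Ioo (0 : ℝ) 1) (hy : y ∈ U) {v vs e : ℝ} (hv : g y = v) (hvs : g xs = vs)
    (hle : vs ≤ v) (hlt : v < vs + η)
    (he : Metric.infEDist 0 (limitingSubdiff g y) ≤ ENNReal.ofReal e) (he0 : 0 ≤ e) :
    (v - vs) ^ θ ≤ c * (1 - θ) * e := by
  have hθ' := sub_pos.2 hθ.2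
  -- At equal values the KL inequality is silent, but `0 ^ θ = 0`.
  rcases hle.eq_or_lt with rfl | hlt'
  · rw [sub_self, Real.zero_rpow hθ.1.ne']
    positivity
  have ht : 0 < v - vs := sub_pos.2 hlt'
  have h1 := h.kl_inequality y hy (by rw [hv, hvs]; exact_mod_cast hlt')
    (by rw [hv, hvs]; exact_mod_cast hlt)
  rw [hv, hvs, EReal.toReal_coe, EReal.toReal_coe, (hasDerivAt_const_mul_rpow ht).deriv] at h1
  have h2 : (1 : ENNReal) ≤ ENNReal.ofReal (c * ((1 - θ) * (v - vs) ^ (-θ)) * e) := by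
    rw [ENNReal.ofReal_mul (by positivity)]
    exact h1.trans (by gcongr)
  rw [ENNReal.one_le_ofReal, Real.rpow_neg ht.le] at h2
  have h3 : 0 < (v - vs) ^ θ := by positivity
  calc (v - vs) ^ θ = (v - vs) ^ θ * 1 := by ring
    _ ≤ (v - vs) ^ θ * (c * ((1 - θ) * ((v - vs) ^ θ)⁻¹) * e) := by gcongr
    _ = c * (1 - θ) * e := by field_simp

/-- An eventually bounded sequence of natural numbers is bounded. -/
theorem exists_forall_le_of_eventually_le {u : ℕ → ℕ} {N : ℕ} (h : ∀ᶠ j in atTop, u j ≤ N) :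
    ∃ N', ∀ j, u j ≤ N' := by
  obtain ⟨J, hJ⟩ := eventually_atTop.1 h
  refine ⟨max N ((Finset.range J).sup u), fun j => ?_⟩
  rcases le_or_gt J j with hj | hj
  · exact (hJ j hj).trans (le_max_left _ _)
  · exact (Finset.le_sup (Finset.mem_range.2 hj)).trans (le_max_right _ _)

/-- The increasing enumeration of an infinite set of natural numbers, starting from an element. -/
theorem exists_strictMono_range_eq {S : Set ℕ} {k₀ : ℕ} (hk₀ : k₀ ∈ S)
    (hS : ∃ᶠ k in atTop, k ∈ S) :
    ∃ s : ℕ → ℕ, StrictMono s ∧ s 0 = k₀ ∧ Set.range s = {k | k ∈ S ∧ k₀ ≤ k} := by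
  have hinf : {k | k ∈ S ∧ k₀ ≤ k}.Infinite :=
    Nat.frequently_atTop_iff_infinite.1 (hS.and_eventually (eventually_ge_atTop k₀))
  refine ⟨Nat.nth fun k => k ∈ S ∧ k₀ ≤ k, Nat.nth_strictMono hinf, ?_,
    Nat.range_nth_of_infinite hinf⟩
  rw [Nat.nth_zero]
  exact le_antisymm (Nat.sInf_le ⟨hk₀, le_rfl⟩) (le_csInf hinf.nonempty fun k hk => hk.2)

theorem StrictMono.apply_succ_le_of_mem_range {s : ℕ → ℕ} (hs : StrictMono s) {j t : ℕ}
    (ht : t ∈ Set.range s) (hlt : s j < t) : s (j + 1) ≤ t := by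
  obtain ⟨m, rfl⟩ := ht
  exact hs.monotone (hs.lt_iff_lt.1 hlt)

/-! ### Assembly: the successful iterates as a `KLDescent` sequence -/

theorem mainTheorem3 {n : ℕ} (f : EuclideanSpace ℝ (Fin n) → ℝ)
    (φ : EuclideanSpace ℝ (Fin n) → EReal) (c₁ σ₂ μmin μmax : ℝ)
    (x xhat : ℕ → EuclideanSpace ℝ (Fin n)) (B : ℕ → Matrix (Fin n) (Fin n) ℝ) (μ : ℕ → ℝ)
    (hblanket : BlanketAssumption f φ)
    (hrun : IsRPQNRun f φ c₁ σ₂ μmin μmax x xhat B μ)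
    (hB : ∃ M : ℝ, 0 < M ∧ ∀ k, ‖Matrix.toEuclideanCLM (𝕜 := ℝ) (B k)‖ ≤ M)
    (hLip : LocLipschitzGradient f φ)
    (xs : EuclideanSpace ℝ (Fin n))
    (hstat : 0 ∈ limitingSubdiff (objective f φ) xs)
    (hacc : MapClusterPt xs (atTop ⊓ 𝓟 (successfulIterations f φ c₁ x xhat B μ)) x)
    (c θ η : ℝ) (U : Set (EuclideanSpace ℝ (Fin n))) (hc : 0 < c) (hθ : θ ∈ Set.Ioo (0 : ℝ) 1)
    (hKL : HasKLProperty (objective f φ) xs (fun t => c * t ^ (1 - θ)) η U)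
    (k₀ : ℕ) (hk₀ : k₀ ∈ successfulIterations f φ c₁ x xhat B μ) :
    -- the objective values that occur below are finite
    (objective f φ xs ≠ ⊥ ∧ objective f φ xs ≠ ⊤) ∧
    (∀ k, objective f φ (x k) ≠ ⊥ ∧ objective f φ (x k) ≠ ⊤) ∧
    -- the increasing enumeration `s` of the successful iterations `≥ k₀`
    ∃ s : ℕ → ℕ, StrictMono s ∧ s 0 = k₀ ∧
      Set.range s = {k | k ∈ successfulIterations f φ c₁ x xhat B μ ∧ k₀ ≤ k} ∧
      (∃ N : ℕ, ∀ j, s (j + 1) - s j ≤ N) ∧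
      (θ < 1 / 2 →
        QSuperlinear (fun k => (objective f φ (x (s k))).toReal) (objective f φ xs).toReal
          (1 / (2 * θ)) ∧
        RSuperlinear (fun k => x (s k)) xs (1 / (2 * θ))) ∧
      (θ = 1 / 2 →
        QLinear (fun k => (objective f φ (x (s k))).toReal) (objective f φ xs).toReal ∧
        RLinear (fun k => x (s k)) xs) ∧
      (1 / 2 < θ →
        ∃ C₁ C₂ : ℝ, 0 < C₁ ∧ 0 < C₂ ∧ ∀ᶠ k : ℕ in atTop,
          (objective f φ (x (s k))).toReal - (objective f φ xs).toReal
            ≤ C₁ * (k : ℝ) ^ (-(1 / (2 * θ - 1))) ∧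
          ‖x (s k) - xs‖ ≤ C₂ * (k : ℝ) ^ (-((1 - θ) / (2 * θ - 1)))) := by
  have hφ := hblanket.proper.1
  have hxs : xs ∈ effDom φ := mem_effDom_objective_iff.1 hstat.1
  have hobj : ∀ k, objective f φ (x k) = ((f (x k) + (φ (x k)).toReal : ℝ) : EReal) :=
    fun k => objective_eq_coe (hφ _) (hrun.mem_effDom k)
  have hobjs : objective f φ xs = ((f xs + (φ xs).toReal : ℝ) : EReal) :=
    objective_eq_coe (hφ _) hxs
  obtain ⟨M, hMpos, hM⟩ := hB
  obtain ⟨ρ, L, G, V, hloc⟩ := exists_localSmoothBounds hblanket hLip hxs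
  obtain ⟨μ₀, hμ₀⟩ := hrun.exists_threshold hblanket hloc hM
  set μhat := max μmax (σ₂ * μ₀)
  have hμhat := hrun.μ_le hμ₀
  have hμhat0 : 0 ≤ μhat := (hrun.μmin_pos.le.trans hrun.μmin_le_μmax).trans (le_max_left _ _)
  obtain ⟨N, hN⟩ := hrun.exists_gap_bound hμ₀
  have hval := hrun.tendsto_value hblanket hloc hM hμhat hxs hacc
  set F : ℕ → ℝ := fun k => f (x k) + (φ (x k)).toReal with hFdef
  set Fs : ℝ := f xs + (φ xs).toReal
  have hanti : Antitone F := hrun.antitone hφ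
  have hfreq : ∀ W ∈ 𝓝 xs, ∃ᶠ k in atTop,
      k ∈ successfulIterations f φ c₁ x xhat B μ ∧ x k ∈ W := fun W hW =>
    frequently_inf_principal.1 (hacc.frequently hW)
  obtain ⟨s, hs, hs0, hrange⟩ := exists_strictMono_range_eq hk₀
    ((hfreq Set.univ univ_mem).mono fun _ hk => hk.1)
  have hsS : ∀ j, s j ∈ successfulIterations f φ c₁ x xhat B μ := fun j =>
    (hrange.subset (Set.mem_range_self j)).1
  have hmem : ∀ k, k ∈ successfulIterations f φ c₁ x xhat B μ → k₀ ≤ k → k ∈ Set.range s :=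
    fun k h1 h2 => hrange.superset ⟨h1, h2⟩
  have hk₀s : ∀ j, k₀ ≤ s j := fun j => hs0 ▸ hs.monotone (Nat.zero_le j)
  -- Only failures lie strictly between two consecutive successes, and failures do not move the
  -- iterate.
  have hconst : ∀ j, x (s (j + 1)) = x (s j + 1) := by
    intro j
    obtain ⟨i, hi⟩ := Nat.exists_eq_add_of_le (hs (Nat.lt_succ_self j) : s j + 1 ≤ s (j + 1))
    rw [hi]
    refine (hrun.eq_of_unsuccessful fun m hm hmS => ?_).1
    have h1 := hs.apply_succ_le_of_mem_range (j := j)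
      (hmem (s j + 1 + m) hmS (by have := hk₀s j; omega)) (by omega)
    omega
  have hFconst : ∀ j, F (s (j + 1)) = F (s j + 1) := fun j => by
    simp only [hFdef, hconst]
  have hUnhds : U ∩ Metric.closedBall xs ρ ∈ 𝓝 xs :=
    inter_mem hKL.nhds (Metric.closedBall_mem_nhds xs hloc.ρ_pos)
  obtain ⟨δ, hδ, hδU⟩ := Metric.mem_nhds_iff.1 hUnhds
  have hball : ∀ p, ‖p - xs‖ < δ → p ∈ U ∧ ‖p - xs‖ ≤ ρ := fun p hp => by
    have h1 := hδU (by rwa [Metric.mem_ball, dist_eq_norm] : p ∈ Metric.ball xs δ)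
    exact ⟨h1.1, by rw [← dist_eq_norm]; exact h1.2⟩
  have hFs : Tendsto (fun j => F (s j)) atTop (𝓝 Fs) := hval.comp hs.tendsto_atTop
  have hle : ∀ k, Fs ≤ F k := fun k => hanti.le_of_tendsto hval k
  -- `a` uses `μ ≥ μmin`; `b` joins the factor `c (1 - θ)` of `χ'` with the subgradient bound. The
  -- radius `δ` keeps both points in `U` and in the `ρ`-ball where `μ ≤ μhat`.
  have hD : KLDescent (fun j => x (s j)) (fun j => F (s j) - Fs) xs (c₁ * μmin / 2)
      (c * (1 - θ) * (L + M + μhat)) θ δ := by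
    have hc₁ := hrun.c₁_mem.1
    have hμmin := hrun.μmin_pos
    have hL := hloc.L_pos
    have hθ1 := sub_pos.2 hθ.2
    refine ⟨by positivity, by positivity, hθ, hδ, fun j => sub_nonneg.2 (hle _), fun j => ?_,
      by simpa using hFs.sub_const Fs, ?_, ?_⟩
    · have h1 := hrun.descent hφ (s j)
      rw [hconst, hFconst]
      linarith
    · have hη : ∀ᶠ j in atTop, F (s (j + 1)) < Fs + η :=
        ((tendsto_add_atTop_iff_nat 1).2 hFs).eventually_lt_const (by linarith [hKL.eta_pos])
      filter_upwards [hη] with j hj hj0 hj1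
      obtain ⟨-, hρ0⟩ := hball _ hj0
      obtain ⟨hU1, hρ1⟩ := hball _ hj1
      have hcb : ∀ p, ‖p - xs‖ ≤ ρ → p ∈ Metric.closedBall xs (2 * ρ) := fun p hp => by
        rw [Metric.mem_closedBall, dist_eq_norm]; linarith [hloc.ρ_pos]
      have hsol := (hsS j).1
      rw [← (hrun.successful _ (hsS j)).1, ← hconst] at hsol
      have hμj := hμhat _ hρ0
      have hdist := hsol.infEDist_le hφ (hrun.mem_effDom _)
        (hloc.differentiableAt _ (hcb _ hρ1)) (hloc.lipschitz _ (hcb _ hρ1) _ (hcb _ hρ0))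
        (hM _) (hμmin.le.trans (hrun.μmin_le _))
      have hdist' := hdist.trans (ENNReal.ofReal_le_ofReal
        (by gcongr : _ ≤ (L + M + μhat) * ‖x (s (j + 1)) - x (s j)‖))
      have := hKL.rpow_le hc hθ hU1 (hobj _) hobjs (hle _) hj hdist' (by positivity)
      rwa [← mul_assoc] at this
    · rw [mapClusterPt_iff_frequently]
      intro W hW
      rw [frequently_atTop]
      intro J
      obtain ⟨k, hk, hkS, hkW⟩ := frequently_atTop.1 (hfreq W hW) (s J)
      obtain ⟨j, rfl⟩ := hmem k hkS ((hk₀s J).trans hk)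
      exact ⟨j, hs.le_iff_le.1 hk, hkW⟩
  -- `N` counts from `s j + 1`, hence `N + 1`. The bound needs `x (s j + 1)` near `xs`, so it holds
  -- only eventually; the finitely many earlier gaps are added at the end.
  have hgap : ∀ᶠ j in atTop, s (j + 1) - s j ≤ N + 1 := by
    have h1 := ((tendsto_add_atTop_iff_nat 1).2 hD.tendsto).eventually
      (Metric.closedBall_mem_nhds xs hloc.ρ_pos)
    filter_upwards [h1] with j hj
    rw [dist_eq_norm, hconst] at hj
    obtain ⟨i, hi, hiS⟩ := hN _ hj
    have h2 := hs.apply_succ_le_of_mem_range (j := j)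
      (hmem _ hiS (by have := hk₀s j; omega)) (by omega)
    omega
  refine ⟨by rw [hobjs]; exact ⟨EReal.coe_ne_bot _, EReal.coe_ne_top _⟩,
    fun k => by rw [hobj]; exact ⟨EReal.coe_ne_bot _, EReal.coe_ne_top _⟩,
    s, hs, hs0, hrange, exists_forall_le_of_eventually_le hgap, ?_⟩
  simp only [hobj, hobjs, EReal.toReal_coe]
  refine ⟨fun h => ⟨?_, hD.rSuperlinear h⟩, fun h => ⟨?_, hD.rLinear h⟩, fun h => hD.sublinear h⟩
  · obtain ⟨h1, -, C, hC, h2⟩ := hD.qSuperlinear h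
    refine ⟨h1, hFs, C, hC, ?_⟩
    simpa only [Real.dist_eq, sub_zero] using h2
  · obtain ⟨-, q, hq, h2⟩ := hD.qLinear h
    refine ⟨hFs, q, hq, ?_⟩
    simpa only [Real.dist_eq, sub_zero] using h2
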